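/- Let $\phi_j$, $j\ge 1$, be an orthonormal system in $\mathbb L_2(0,1)$. For $\varepsilon>0$ one observes $dY_\varepsilon(t)=S(t)\,dt+\varepsilon\,dw(t)$, $t\in[0,1]$, through its Fourier coefficients $y_{\varepsilon j}=\int_0^1\phi_j\,dY_\varepsilon=\theta_j+\varepsilon\xi_j$, where $\theta_j=\int_0^1 S\phi_j\,dt$ and the $\xi_j=\int_0^1\phi_j\,dw$ are independent standard Gaussian. Let $0<r<1/2$ and $0<2\omega<1-2r$, and put $s=\dfrac{r}{2-4r-2\omega}$. All relations $\asymp$ (two-sided bounds with positive constants) are meant as $\varepsilon\to0$. Let $\varkappa_{\varepsilon j}^2\ge 0$ be coefficients with $\rho_\varepsilon^2=\sum_j\varkappa_{\varepsilon j}^2<\infty$ for every $\varepsilon>0$, and put $A_\varepsilon=\varepsilon^{-4}\sum_j\varkappa_{\varepsilon j}^4$, $k_\varepsilon=\sup\{k\ge1:\sum_{j<k}\varkappa_{\varepsilon j}^2\le\frac12\rho_\varepsilon^2\}$, $\varkappa_\varepsilon^2=\varkappa_{\varepsilon k_\varepsilon}^2$. Assume $k_\varepsilon\asymp\varepsilon^{-4+8r+4\omega}$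 and * A1: for each $\varepsilon>0$ the sequence $\varkappa_{\varepsilon j}^2$ is non-increasing in $j$; * A2: there are constants $C_1,C_2>0$ with $C_1<A_\varepsilon<C_2$ for all $\varepsilon>0$; * A3: there are $C_1>0$ and $\lambda>1$ such that $\varkappa^2_{\varepsilon,[(1+\delta)k_\varepsilon]}<C_1(1+\delta)^{-\lambda}\varkappa_\varepsilon^2$ for all $\delta>0$ and $\varepsilon>0$; * A4: $\varkappa_{\varepsilon1}^2\asymp\varkappa_\varepsilon^2$, and for every $c>1$ there is $C>0$ with $\varkappa^2_{\varepsilon,[ck_\varepsilon]}\ge C\varkappa_\varepsilon^2$ for all $\varepsilon>0$. Consider the tests $L_\varepsilon=\mathbf 1\{A_\varepsilon^{-1/2}T_\varepsilon>x_\varepsilon\}$ with $T_\varepsilon=\varepsilon^{-2}\sum_j\varkappa_{\varepsilon j}^2y_{\varepsilon j}^2-\rho_\varepsilon^2$ and arbitrary real thresholds $x_\varepsilon$; let $\alpha(L_\varepsilon)=\mathbf E_0L_\varepsilon$ and $\beta(L_\varepsilon,S)=\mathbf E_S(1-L_\varepsilon)$. A family $S_\varepsilon\in\mathbb L_2(0,1)$,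 $\varepsilon\to0$, is $\varepsilon^{-2\omega}$-LD consistent if, for every choice of thresholds with $\varepsilon^{4\omega}\log\alpha(L_\varepsilon)\to0$, there is a constant $C>0$ with $\varepsilon^{-4\omega}\le C\,|\log\beta(L_\varepsilon,S_\varepsilon)|$ for all small $\varepsilon$ (with $\log 0=-\infty$); for a sequence of alternatives observed at noise levels $\varepsilon_i\to0$ the definition is the same along the sequence. A family $S_\varepsilon$ with $\|S_\varepsilon\|\asymp\varepsilon^{2r}$ is purely $\varepsilon^{-2\omega}$-LD consistent if it is $\varepsilon^{-2\omega}$-LD consistent and there are no $\varepsilon_i>0$ with $\varepsilon_i\to0$, no $c_1>0$ and no sequence $S_{1\varepsilon_i}\in\mathbb L_2(0,1)$, not $\varepsilon_i^{-2\omega}$-LD consistent, such that for all $i$ the function $S_{1\varepsilon_i}$ is orthogonal to $S_{\varepsilon_i}-S_{1\varepsilon_i}$ and $\|S_{1\varepsilon_i}\|>c_1\varepsilon_i^{2r}$. For $P_0>0$ let $$\bar{\mathbb B}^s_{2\infty}(P_0)=\Bigl\{S=\sum_{j=1}^\infty\theta_j\phi_j:\ \sup_{\lambda>0}\lambda^{2s}\sum_{j>\lambda}\theta_j^2\le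 P_0\Bigr\}.$$ **Theorem.** Let $S_\varepsilon\in\mathbb L_2(0,1)$, $\varepsilon>0$, be a family with $\|S_\varepsilon\|\asymp\varepsilon^{2r}$. Then $S_\varepsilon$ is purely $\varepsilon^{-2\omega}$-LD consistent if and only if for every $\delta>0$ there are $P_0>0$, functions $S_{1\varepsilon}\in\bar{\mathbb B}^s_{2\infty}(P_0)$, $\varepsilon>0$, and $\varepsilon_0>0$ such that $\|S_\varepsilon-S_{1\varepsilon}\|\le\delta\varepsilon^{2r}$ for all $0<\varepsilon<\varepsilon_0$. -/

import Mathlib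

open MeasureTheory ProbabilityTheory Filter Topology Asymptotics

noncomputable section

namespace SignalDetection

/-- The Hilbert space `L₂(0,1)`. -/
abbrev L2 : Type := Lp ℝ 2 (volume.restrict (Set.Ioo (0 : ℝ) 1))

/-- The Fourier coefficient `θ_j = ∫₀¹ S φ_j dt`. -/
def coeff (φ : ℕ+ → L2) (S : L2) (j : ℕ+) : ℝ := inner ℝ (φ j) S

/-- The model `dY_ε(t) = S(t) dt + ε dw(t)` in Fourier coordinates: the law of the sequence
`y_{εj} = θ_j + ε ξ_j`, `j ≥ 1`, where the `ξ_j = ∫₀¹ φ_j dw` are independent standard Gaussian. -/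
def obsLaw (φ : ℕ+ → L2) (ε : ℝ) (S : L2) : Measure (ℕ+ → ℝ) :=
  Measure.infinitePi fun j => gaussianReal (coeff φ S j) (ε ^ 2).toNNReal

/-- `ρ² = ∑_j ϰ_j²`. -/
def rhoSq (ϰ : ℕ+ → ℝ) : ℝ := ∑' j, ϰ j ^ 2

/-- `A_ε = ε⁻⁴ ∑_j ϰ_j⁴`. -/
def bigA (ϰ : ℕ+ → ℝ) (ε : ℝ) : ℝ := ε⁻¹ ^ 4 * ∑' j, ϰ j ^ 4

/-- `k = sup {k : ∑_{j<k} ϰ_j² ≤ ρ²/2}`, the indices `k` being positive integers. -/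
def cutoff (ϰ : ℕ+ → ℝ) : ℕ :=
  sSup ((fun k : ℕ+ => (k : ℕ)) '' {k : ℕ+ | ∑ j ∈ Finset.Iio k, ϰ j ^ 2 ≤ rhoSq ϰ / 2})

/-- `ϰ²_m` for a natural number `m ≥ 1` (the value at `m = 0`, which is not used, is `ϰ²_1`). -/
def sqAt (ϰ : ℕ+ → ℝ) (m : ℕ) : ℝ := ϰ m.toPNat' ^ 2

/-- `ϰ_ε² = ϰ²_{ε, k_ε}`. -/
def cutoffSq (ϰ : ℕ+ → ℝ) : ℝ := sqAt ϰ (cutoff ϰ)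

/-- A1: for each `ε` the sequence `ϰ²_{εj}` is decreasing in `j` (not necessarily strictly). -/
def CondA1 (ϰ : ℝ → ℕ+ → ℝ) : Prop :=
  ∀ ε : ℝ, 0 < ε → Antitone fun j => ϰ ε j ^ 2

/-- A2: `C₁ < A_ε < C₂`. -/
def CondA2 (ϰ : ℝ → ℕ+ → ℝ) : Prop :=
  ∃ C₁ C₂ : ℝ, 0 < C₁ ∧ 0 < C₂ ∧ ∀ ε : ℝ, 0 < ε → C₁ < bigA (ϰ ε) ε ∧ bigA (ϰ ε) ε < C₂

/-- A3: `ϰ²_{ε,[(1+δ)k_ε]} < C₁ (1+δ)^{-λ} ϰ_ε²` for all `δ > 0` and all `ε`, with `λ > 1`. -/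
def CondA3 (ϰ : ℝ → ℕ+ → ℝ) : Prop :=
  ∃ C₁ lam : ℝ, 0 < C₁ ∧ 1 < lam ∧ ∀ δ : ℝ, 0 < δ → ∀ ε : ℝ, 0 < ε →
    sqAt (ϰ ε) ⌊(1 + δ) * (cutoff (ϰ ε) : ℝ)⌋₊ < C₁ * (1 + δ) ^ (-lam) * cutoffSq (ϰ ε)

/-- A4: `ϰ²_{ε1} ≍ ϰ_ε²` as `ε → 0`, and for every `c > 1` there is `C > 0` with
`ϰ²_{ε,[c k_ε]} ≥ C ϰ_ε²` for all `ε > 0`. -/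
def CondA4 (ϰ : ℝ → ℕ+ → ℝ) : Prop :=
  ((fun ε => ϰ ε 1 ^ 2) =Θ[𝓝[>] (0 : ℝ)] fun ε => cutoffSq (ϰ ε)) ∧
  ∀ c : ℝ, 1 < c → ∃ C : ℝ, 0 < C ∧ ∀ ε : ℝ, 0 < ε →
    C * cutoffSq (ϰ ε) ≤ sqAt (ϰ ε) ⌊c * (cutoff (ϰ ε) : ℝ)⌋₊

/-- The test statistic `T_ε = ε⁻² ∑_j ϰ²_{εj} y_j² - ρ_ε²`. -/
def stat (ϰ : ℕ+ → ℝ) (ε : ℝ) (y : ℕ+ → ℝ) : ℝ :=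
  ε⁻¹ ^ 2 * (∑' j, ϰ j ^ 2 * y j ^ 2) - rhoSq ϰ

/-- The rejection region `A_ε^{-1/2} T_ε > x` of the test `L_ε` with threshold `x`. -/
def rejectRegion (ϰ : ℕ+ → ℝ) (ε x : ℝ) : Set (ℕ+ → ℝ) :=
  {y | x < (bigA ϰ ε) ^ (-(1 / 2 : ℝ)) * stat ϰ ε y}

/-- Type I error probability `α(L_ε) = E₀ L_ε` of the test with threshold `x`. -/
def typeI (φ : ℕ+ → L2) (ϰ : ℕ+ → ℝ) (ε x : ℝ) : ℝ :=
  (obsLaw φ ε 0).real (rejectRegion ϰ ε x)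

/-- Type II error probability `β(L_ε, S) = E_S (1 - L_ε)` of the test with threshold `x`. -/
def typeII (φ : ℕ+ → L2) (ϰ : ℕ+ → ℝ) (ε x : ℝ) (S : L2) : ℝ :=
  (obsLaw φ ε S).real (rejectRegion ϰ ε x)ᶜ

/-- `R`-LD consistency of the alternatives `S i`, observed at the noise levels `e i`, along the
filter `l` (a family indexed by `ε → 0+`, or a sequence): for every choice `x` of thresholds with
`R⁻² log α → 0`, one has `|log β| = Ω(R²)`, that is `R² ≤ C |log β|` for some constant `C`
and all indices far enough along `l`. Here `log 0 = -∞`: the first condition forces `α > 0`,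
and the second one holds when `β = 0`. -/
def LDConsistentAlong {ι : Type} (φ : ℕ+ → L2) (ϰ : ℝ → ℕ+ → ℝ) (R : ℝ → ℝ)
    (l : Filter ι) (e : ι → ℝ) (S : ι → L2) : Prop :=
  ∀ x : ι → ℝ,
    (∀ᶠ i in l, 0 < typeI φ (ϰ (e i)) (e i) (x i)) →
    Tendsto (fun i => Real.log (typeI φ (ϰ (e i)) (e i) (x i)) / R (e i) ^ 2) l (𝓝 0) →
    ∃ C : ℝ, 0 < C ∧ ∀ᶠ i in l,
      typeII φ (ϰ (e i)) (e i) (x i) (S i) = 0 ∨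
        R (e i) ^ 2 ≤ C * |Real.log (typeII φ (ϰ (e i)) (e i) (x i) (S i))|

/-- `R`-LD consistency of a family `S ε`, `ε > 0`, as `ε → 0`. -/
def LDConsistent (φ : ℕ+ → L2) (ϰ : ℝ → ℕ+ → ℝ) (R : ℝ → ℝ) (S : ℝ → L2) : Prop :=
  LDConsistentAlong φ ϰ R (𝓝[>] (0 : ℝ)) (fun ε => ε) S

/-- Pure `R`-LD consistency of a family `S ε` with `‖S ε‖ ≍ ε^{2r}`: it is `R`-LD consistent, and
there is no `R`-LD inconsistent sequence `S₁ i` at noise levels `e i → 0` with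
`S₁ i ⟂ S (e i) - S₁ i` and `‖S₁ i‖ > c₁ (e i)^{2r}` for some constant `c₁ > 0`. -/
def PurelyLDConsistent (φ : ℕ+ → L2) (ϰ : ℝ → ℕ+ → ℝ) (R : ℝ → ℝ) (r : ℝ) (S : ℝ → L2) : Prop :=
  LDConsistent φ ϰ R S ∧
  ¬ ∃ (e : ℕ → ℝ) (S₁ : ℕ → L2) (c₁ : ℝ),
      (∀ i, 0 < e i) ∧ Tendsto e atTop (𝓝 0) ∧ 0 < c₁ ∧
      (∀ i, inner ℝ (S₁ i) (S (e i) - S₁ i) = 0) ∧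
      (∀ i, c₁ * e i ^ (2 * r) < ‖S₁ i‖) ∧
      ¬ LDConsistentAlong φ ϰ R atTop e S₁

/-- The ball `{S = ∑ θ_j φ_j : sup_{λ>0} λ^{2s} ∑_{j>λ} θ_j² ≤ P₀}`. -/
def besovBall (φ : ℕ+ → L2) (s P₀ : ℝ) : Set L2 :=
  {S | HasSum (fun j => coeff φ S j • φ j) S ∧
    ∀ lam : ℝ, 0 < lam →
      lam ^ (2 * s) * ∑' j : {j : ℕ+ // lam < ((j : ℕ) : ℝ)}, coeff φ S j ^ 2 ≤ P₀}

end SignalDetection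

end

/-!
After division by `ε²` the test statistic is the centred weighted chi-square sum
`∑_j b_j ((μ_j + ξ_j)² - 1)` with `b_j = ε⁻² ϰ_j²` and `μ_j = θ_j / ε`; its variance under the null
hypothesis is of order `A_ε`, hence bounded above and below, and the alternative `S` shifts its mean
by `ε⁻⁴ ∑_j ϰ_j² θ_j²`. Put `R = ε^{-2ω}`. As `R b_j → 0` uniformly in `j`, the exponential moments
with tilt of order `R` are those of a Gaussian variable up to constants. Chernoff bounds then give
LD consistency when the shift is at least of order `R`. If the shift is `o(R)`, a threshold between
the shift and `R` has `log α = o(R²)`, by a tilting lower bound for the upper tail, and a type II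
error that is at least `1/2`.

The assumptions on the weights give `ϰ_ε² ≍ ε^{4-4r-2ω}`, so that signals of norm of order `ε^{2r}`
produce a shift of order `R` when their frequencies are of the order of the cutoff `k_ε`, and a
shift `o(R)` when these are much larger than `k_ε`. If the components of `S_ε` beyond `c k_ε` are
not small uniformly in large `c`, they thus form an inconsistent orthogonal component. If they are
small, an orthogonal component `T` of `S_ε` satisfies `‖T‖² = ⟪T, S_ε⟫`, and therefore has
substantial energy at low frequencies itself. Finally, since `k_ε^{2s} ε^{4r} ≍ 1`, concentration on
the frequencies of the order of `k_ε` means approximation by a Besov ball of smoothness `s`.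
-/

open scoped NNReal

noncomputable section

namespace SignalDetection

section GaussianMGF

lemma complete_square_gaussian_exponent {m v t : ℝ} (hv : v ≠ 0) (hd : 1 - 2 * t * v ≠ 0)
    (z : ℝ) :
    -(z - m) ^ 2 / (2 * v) + t * z ^ 2 = t * m ^ 2 / (1 - 2 * t * v) +
      -(z - m / (1 - 2 * t * v)) ^ 2 / (2 * (v / (1 - 2 * t * v))) := by
  obtain ⟨d, rfl⟩ : ∃ d, t = (1 - d) / (2 * v) := ⟨1 - 2 * t * v, by field_simp; ring⟩
  have hden : 1 - 2 * ((1 - d) / (2 * v)) * v = d := by field_simp; ring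
  rw [hden] at hd ⊢
  field_simp
  ring

lemma mgf_sq_gaussianReal (m : ℝ) (v : ℝ≥0) {t : ℝ} (ht : 2 * t * v < 1) :
    mgf (fun z => z ^ 2) (gaussianReal m v) t =
      Real.exp (t * m ^ 2 / (1 - 2 * t * v)) / √(1 - 2 * t * v) := by
  have hd : 0 < 1 - 2 * t * v := by linarith
  rcases eq_or_ne v 0 with rfl | hv
  · simp [mgf]
  have hv0 : (0 : ℝ) < v := by positivity
  obtain ⟨w, hw⟩ : ∃ w : ℝ≥0, (w : ℝ) = v / (1 - 2 * t * v) := CanLift.prf _ (by positivity)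
  have hw0 : w ≠ 0 := by
    rw [← NNReal.coe_ne_zero, hw]
    positivity
  have tilt (z : ℝ) : gaussianPDFReal m v z • Real.exp (t * z ^ 2) =
      Real.exp (t * m ^ 2 / (1 - 2 * t * v)) / √(1 - 2 * t * v) *
        gaussianPDFReal (m / (1 - 2 * t * v)) w z := by
    simp only [gaussianPDFReal, hw, smul_eq_mul]
    rw [mul_assoc, ← Real.exp_add, complete_square_gaussian_exponent hv0.ne' hd.ne',
      ← mul_div_assoc (2 * Real.pi), Real.sqrt_div (by positivity), Real.exp_add]
    have hq := (Real.sqrt_pos.2 hd).ne'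
    generalize √(1 - 2 * t * v) = q at *
    field_simp
  simp_rw [mgf, integral_gaussianReal_eq_integral_smul hv, tilt]
  rw [integral_const_mul, integral_gaussianPDFReal_eq_one _ hw0, mul_one]

/-- The logarithm of `𝔼 exp (x * ((μ + ξ)² - 1))` for a standard Gaussian variable `ξ` and
`2 * x < 1`. -/
def logMGF (x μ : ℝ) : ℝ := -(1 / 2) * Real.log (1 - 2 * x) - x + x * μ ^ 2 / (1 - 2 * x)

lemma abs_log_one_sub_le {z : ℝ} (hz : |z| ≤ 1 / 4) :
    |z + z ^ 2 / 2 + Real.log (1 - z)| ≤ z ^ 2 / 3 := by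
  have h := Real.abs_log_sub_add_sum_range_le (x := z) (by linarith) 2
  norm_num [Finset.sum_range_succ] at h
  refine h.trans ?_
  rw [div_le_iff₀ (by linarith), ← sq_abs z]
  nlinarith [abs_nonneg z, mul_nonneg (sq_nonneg |z|) (sub_nonneg.2 hz)]

lemma logMGF_le_of_nonneg {x : ℝ} (hx₀ : 0 ≤ x) (hx : x ≤ 1 / 8) (μ : ℝ) :
    logMGF x μ ≤ 2 * x ^ 2 + 2 * (x * μ ^ 2) := by
  have hlog := (abs_le.1 (abs_log_one_sub_le (z := 2 * x)
    (abs_le.2 (by constructor <;> linarith)))).1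
  have hmean : x * μ ^ 2 / (1 - 2 * x) ≤ 2 * (x * μ ^ 2) := by
    rw [div_le_iff₀ (by linarith)]
    nlinarith [mul_nonneg hx₀ (sq_nonneg μ)]
  unfold logMGF
  nlinarith

lemma logMGF_le_of_nonpos {x : ℝ} (hx₀ : x ≤ 0) (hx : -(1 / 8) ≤ x) (μ : ℝ) :
    logMGF x μ ≤ 2 * x ^ 2 + 1 / 2 * (x * μ ^ 2) := by
  have hlog := (abs_le.1 (abs_log_one_sub_le (z := 2 * x)
    (abs_le.2 (by constructor <;> linarith)))).1
  have hmean : x * μ ^ 2 / (1 - 2 * x) ≤ 1 / 2 * (x * μ ^ 2) := by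
    rw [div_le_iff₀ (by linarith)]
    nlinarith [mul_nonneg (neg_nonneg.2 hx₀) (sq_nonneg μ)]
  unfold logMGF
  nlinarith

lemma sq_div_three_le_logMGF_zero {x : ℝ} (hx : |x| ≤ 1 / 8) : x ^ 2 / 3 ≤ logMGF x 0 := by
  have hlog := (abs_le.1 (abs_log_one_sub_le (z := 2 * x)
    (by rw [abs_mul, abs_two]; linarith))).2
  have hzero : logMGF x 0 = -(1 / 2) * Real.log (1 - 2 * x) - x := by simp [logMGF]
  nlinarith

variable {Ω : Type*} {mΩ : MeasurableSpace Ω} {P : Measure Ω} {Y : Ω → ℝ} {m t b : ℝ}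

lemma mgf_mul_sq_sub_one_of_hasLaw (hY : HasLaw Y (gaussianReal m 1) P) (ht : 2 * (t * b) < 1) :
    mgf (fun ω => b * (Y ω ^ 2 - 1)) P t = Real.exp (logMGF (t * b) m) := by
  have hd : 0 < 1 - 2 * (t * b) := by linarith
  have hlaw : mgf (fun ω => Y ω ^ 2) P (b * t) =
      mgf (fun z => z ^ 2) (gaussianReal m 1) (b * t) := by
    rw [← hY.map_eq, mgf_map hY.aemeasurable (by fun_prop)]
    rfl
  have hsqrt : √(1 - 2 * (t * b)) = Real.exp (1 / 2 * Real.log (1 - 2 * (t * b))) := by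
    rw [← Real.exp_log (Real.sqrt_pos.2 hd), Real.log_sqrt hd.le, div_eq_inv_mul, one_div]
  have hvar : 2 * (b * t) * ((1 : ℝ≥0) : ℝ) = 2 * (t * b) := by push_cast; ring
  simp_rw [mgf_const_mul, sub_eq_add_neg]
  rw [mgf_add_const, hlaw, mgf_sq_gaussianReal _ _ (hvar.trans_lt ht), hvar, hsqrt,
    ← Real.exp_sub, ← Real.exp_add, logMGF]
  congr 1
  ring

end GaussianMGF

section ExponentialMoments

variable {Ω κ : Type*} {mΩ : MeasurableSpace Ω} {P : Measure Ω}

lemma integrable_and_integral_le_of_tendsto {l : Filter κ} [l.NeBot] [l.IsCountablyGenerated]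
    {f : κ → Ω → ℝ} {g : Ω → ℝ} {B : κ → ℝ} {β : ℝ} (hf : ∀ k, Integrable (f k) P)
    (hf₀ : ∀ k ω, 0 ≤ f k ω) (hfB : ∀ k, ∫ ω, f k ω ∂P ≤ B k)
    (hfg : ∀ᵐ ω ∂P, Tendsto (fun k => f k ω) l (𝓝 (g ω))) (hB : Tendsto B l (𝓝 β)) :
    Integrable g P ∧ ∫ ω, g ω ∂P ≤ β := by
  have hg₀ : 0 ≤ᵐ[P] g := hfg.mono fun ω hω => ge_of_tendsto' hω fun k => hf₀ k ω
  have hgm : AEStronglyMeasurable g P :=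
    aestronglyMeasurable_of_tendsto_ae l (fun k => (hf k).aestronglyMeasurable) hfg
  have fatou : ∫⁻ ω, ENNReal.ofReal (g ω) ∂P ≤ ENNReal.ofReal β := calc
    _ = ∫⁻ ω, liminf (fun k => ENNReal.ofReal (f k ω)) l ∂P := by
      refine lintegral_congr_ae (hfg.mono fun ω hω => ?_)
      exact (ENNReal.tendsto_ofReal hω).liminf_eq.symm
    _ ≤ liminf (fun k => ∫⁻ ω, ENNReal.ofReal (f k ω) ∂P) l :=
      lintegral_liminf_le' fun k => (hf k).aemeasurable.ennreal_ofReal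
    _ ≤ liminf (fun k => ENNReal.ofReal (B k)) l := by
      refine liminf_le_liminf (Eventually.of_forall fun k => ?_)
      rw [← ofReal_integral_eq_lintegral_ofReal (hf k) (ae_of_all _ (hf₀ k))]
      exact ENNReal.ofReal_le_ofReal (hfB k)
    _ = ENNReal.ofReal β := (ENNReal.tendsto_ofReal hB).liminf_eq
  have hβ : 0 ≤ β := ge_of_tendsto' hB fun k => (integral_nonneg (hf₀ k)).trans (hfB k)
  refine ⟨⟨hgm, (hasFiniteIntegral_iff_ofReal hg₀).2 (fatou.trans_lt ENNReal.ofReal_lt_top)⟩, ?_⟩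
  rw [integral_eq_lintegral_of_nonneg_ae hg₀ hgm]
  exact ENNReal.toReal_le_of_le_ofReal hβ fatou

lemma mgf_le_exp_add_sqrt_mgf_mul_sqrt_measureReal [IsProbabilityMeasure P] {Z : Ω → ℝ}
    {t : ℝ} (ht : 0 ≤ t) (hZ : AEMeasurable Z P)
    (hint : Integrable (fun ω => Real.exp (2 * t * Z ω)) P) (u : ℝ) :
    mgf Z P t ≤ Real.exp (t * u) + √(mgf Z P (2 * t)) * √(P.real {ω | u < Z ω}) := by
  set E : Set Ω := {ω | u < Z ω}
  have hE : NullMeasurableSet E P := nullMeasurableSet_lt aemeasurable_const hZ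
  have hexp_sq (ω : Ω) : Real.exp (t * Z ω) ^ 2 = Real.exp (2 * t * Z ω) := by
    rw [← Real.exp_nat_mul]
    congr 1
    push_cast
    ring
  have hexp : MemLp (fun ω => Real.exp (t * Z ω)) 2 P := by
    refine (memLp_two_iff_integrable_sq (by fun_prop)).2 ?_
    simpa only [hexp_sq] using hint
  have hE_le : ∫ ω in E, Real.exp (t * Z ω) ∂P ≤ √(mgf Z P (2 * t)) * √(P.real E) := by
    have h := integral_mul_le_Lp_mul_Lq_of_nonneg (μ := P.restrict E) (g := fun _ => 1)
      Real.HolderConjugate.two_two (ae_of_all _ fun ω => (Real.exp_pos (t * Z ω)).le)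
      (ae_of_all _ fun _ => zero_le_one) (by simpa using hexp.restrict E) (memLp_const 1)
    simp only [mul_one, Real.rpow_ofNat, hexp_sq, one_pow, integral_const, smul_eq_mul,
      measureReal_restrict_apply_univ, ← Real.sqrt_eq_rpow] at h
    refine h.trans (mul_le_mul_of_nonneg_right (Real.sqrt_le_sqrt ?_) (Real.sqrt_nonneg _))
    exact setIntegral_le_integral hint (ae_of_all _ fun ω => (Real.exp_pos _).le)
  have hEc_le : ∫ ω in Eᶜ, Real.exp (t * Z ω) ∂P ≤ Real.exp (t * u) := by
    have h := norm_setIntegral_le_of_norm_le_const (μ := P) (s := Eᶜ) (measure_lt_top _ _)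
      (f := fun ω => Real.exp (t * Z ω)) (C := Real.exp (t * u)) fun ω hω => by
        rw [Real.norm_of_nonneg (Real.exp_pos _).le]
        exact Real.exp_le_exp.2 (mul_le_mul_of_nonneg_left (not_lt.1 hω) ht)
    exact (le_abs_self _).trans
      (h.trans (mul_le_of_le_one_right (Real.exp_pos _).le measureReal_le_one))
  have hsplit := integral_add_compl₀ hE (hexp.integrable one_le_two)
  rw [mgf, ← hsplit, add_comm]
  exact add_le_add hEc_le hE_le

end ExponentialMoments

section ChiSquareSum

variable {Ω ι : Type*} {mΩ : MeasurableSpace Ω} {P : Measure Ω}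
  {Y : ι → Ω → ℝ} {Z : Ω → ℝ} {m b : ι → ℝ} {t u : ℝ}

lemma lintegral_sq_gaussianReal (m : ℝ) (v : ℝ≥0) :
    ∫⁻ z, ENNReal.ofReal (z ^ 2) ∂gaussianReal m v = ENNReal.ofReal (m ^ 2 + v) := by
  have hid : MemLp id 2 (gaussianReal m v) := memLp_id_gaussianReal 2
  have hvar := variance_eq_sub hid
  rw [variance_id_gaussianReal] at hvar
  simp only [id_eq, integral_id_gaussianReal, Pi.pow_apply] at hvar
  have hsq : ∫ z, z ^ 2 ∂gaussianReal m v = m ^ 2 + v := by linarith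
  rw [← hsq]
  exact (ofReal_integral_eq_lintegral_ofReal hid.integrable_sq
    (ae_of_all _ fun z => sq_nonneg z)).symm

lemma ae_summable_mul_sq [Countable ι] (hY : ∀ j, HasLaw (Y j) (gaussianReal (m j) 1) P)
    (hb₀ : ∀ j, 0 ≤ b j) (hb : Summable b) (hbm : Summable fun j => b j * m j ^ 2) :
    ∀ᵐ ω ∂P, Summable fun j => b j * Y j ω ^ 2 := by
  have hmeas (j : ι) : AEMeasurable (fun ω => ENNReal.ofReal (b j * Y j ω ^ 2)) P :=
    (((hY j).aemeasurable.pow_const 2).const_mul (b j)).ennreal_ofReal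
  have hmean (j : ι) : ∫⁻ ω, ENNReal.ofReal (b j * Y j ω ^ 2) ∂P =
      ENNReal.ofReal (b j * m j ^ 2 + b j) := by
    simp_rw [ENNReal.ofReal_mul (hb₀ j)]
    rw [lintegral_const_mul' _ _ ENNReal.ofReal_ne_top,
      (hY j).lintegral_comp (f := fun z => ENNReal.ofReal (z ^ 2)) (by fun_prop),
      lintegral_sq_gaussianReal, ← ENNReal.ofReal_mul (hb₀ j), NNReal.coe_one, mul_add, mul_one]
  have hfin : ∫⁻ ω, ∑' j, ENNReal.ofReal (b j * Y j ω ^ 2) ∂P ≠ ⊤ := by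
    rw [lintegral_tsum hmeas]
    simp_rw [hmean]
    exact (hbm.add hb).tsum_ofReal_ne_top
  filter_upwards [ae_lt_top' (AEMeasurable.tsum hmeas) hfin] with ω hω
  exact (ENNReal.summable_toReal hω.ne).congr fun j =>
    ENNReal.toReal_ofReal (mul_nonneg (hb₀ j) (sq_nonneg _))

lemma summable_sq_of_nonneg (hb₀ : ∀ j, 0 ≤ b j) (hb : Summable b) :
    Summable fun j => b j ^ 2 := by
  refine Summable.of_nonneg_of_le (fun j => sq_nonneg _) (fun j => ?_) (hb.mul_left (∑' i, b i))
  rw [sq]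
  exact mul_le_mul_of_nonneg_right (hb.le_tsum j fun i _ => hb₀ i) (hb₀ j)

lemma exp_neg_le_of_exp_le_add_mul_sqrt {v p : ℝ} (hv : 1 / 2 ≤ v)
    (h : Real.exp (12 * v) ≤ Real.exp (6 * v) + Real.exp (144 * v) * √p) :
    Real.exp (-288 * v) ≤ p := by
  have hgap : Real.exp (6 * v) + 1 ≤ Real.exp (12 * v) := by
    rw [show 12 * v = 6 * v + 6 * v by ring, Real.exp_add]
    nlinarith [Real.add_one_le_exp (6 * v)]
  have hroot : Real.exp (-144 * v) ≤ √p := by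
    rw [neg_mul, Real.exp_neg, inv_le_iff_one_le_mul₀' (Real.exp_pos _)]
    linarith
  calc Real.exp (-288 * v) = Real.exp (-144 * v) ^ 2 := by
        rw [← Real.exp_nat_mul]; congr 1; push_cast; ring
    _ ≤ p := (Real.le_sqrt' (Real.exp_pos _)).1 hroot

/-- `Z` is almost surely the centred weighted chi-square sum `∑ j, b j * (Y j ^ 2 - 1)`, where the
`Y j` are independent Gaussian variables with means `m j` and variance one, and the weights `b j`
are nonnegative with `∑ j, b j` and `∑ j, b j * m j ^ 2` finite. -/
structure IsChiSquareSum (Y : ι → Ω → ℝ) (m b : ι → ℝ) (Z : Ω → ℝ) (P : Measure Ω) : Prop where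
  hasLaw : ∀ j, HasLaw (Y j) (gaussianReal (m j) 1) P
  indep : iIndepFun Y P
  nonneg : ∀ j, 0 ≤ b j
  summable : Summable b
  summable_mul_sq : Summable fun j => b j * m j ^ 2
  ae_hasSum : ∀ᵐ ω ∂P, HasSum (fun j => b j * (Y j ω ^ 2 - 1)) (Z ω)

namespace IsChiSquareSum

lemma aemeasurable [Countable ι] (h : IsChiSquareSum Y m b Z P) : AEMeasurable Z P :=
  aemeasurable_of_tendsto_metrizable_ae atTop
    (fun s => Finset.aemeasurable_fun_sum s fun j _ =>
      (((h.hasLaw j).aemeasurable.pow_const 2).sub_const 1).const_mul (b j)) h.ae_hasSum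

lemma integrable_exp_and_mgf_sum (h : IsChiSquareSum Y m b Z P) (ht : ∀ j, 2 * (t * b j) < 1)
    (s : Finset ι) :
    Integrable (fun ω => Real.exp (t * ∑ j ∈ s, b j * (Y j ω ^ 2 - 1))) P ∧
      mgf (fun ω => ∑ j ∈ s, b j * (Y j ω ^ 2 - 1)) P t =
        Real.exp (∑ j ∈ s, logMGF (t * b j) (m j)) := by
  have := h.indep.isProbabilityMeasure
  have hindep : iIndepFun (fun j ω => b j * (Y j ω ^ 2 - 1)) P :=
    h.indep.comp (fun j z => b j * (z ^ 2 - 1)) fun j => by fun_prop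
  have hmeas (j : ι) : AEMeasurable (fun ω => b j * (Y j ω ^ 2 - 1)) P :=
    (((h.hasLaw j).aemeasurable.pow_const 2).sub_const 1).const_mul (b j)
  have heq : mgf (fun ω => ∑ j ∈ s, b j * (Y j ω ^ 2 - 1)) P t =
      Real.exp (∑ j ∈ s, logMGF (t * b j) (m j)) := by
    have hmgf := hindep.mgf_sum₀ (t := t) hmeas s
    simp_rw [mgf_mul_sq_sub_one_of_hasLaw (h.hasLaw _) (ht _), ← Real.exp_sum] at hmgf
    rw [← hmgf]
    congr 1
    ext ω
    simp
  refine ⟨?_, heq⟩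
  by_contra hnot
  exact (Real.exp_pos _).ne ((mgf_undef hnot).symm.trans heq)

lemma integrable_exp_and_mgf_le [Countable ι] (h : IsChiSquareSum Y m b Z P)
    (ht : ∀ j, 2 * (t * b j) < 1) {g : ι → ℝ} {B : ℝ}
    (hg : ∀ j, logMGF (t * b j) (m j) ≤ g j) (hB : HasSum g B) :
    Integrable (fun ω => Real.exp (t * Z ω)) P ∧ mgf Z P t ≤ Real.exp B := by
  refine integrable_and_integral_le_of_tendsto (l := atTop)
    (fun s => (h.integrable_exp_and_mgf_sum ht s).1)
    (fun _ _ => (Real.exp_pos _).le) (B := fun s => Real.exp (∑ j ∈ s, g j)) (fun s => ?_)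
    (h.ae_hasSum.mono fun ω hω => (Real.continuous_exp.tendsto _).comp (hω.const_mul t))
    ((Real.continuous_exp.tendsto _).comp hB)
  refine (h.integrable_exp_and_mgf_sum ht s).2.trans_le ?_
  exact Real.exp_le_exp.2 (Finset.sum_le_sum fun j _ => hg j)

lemma exp_le_mgf (h : IsChiSquareSum Y m b Z P) (ht₀ : 0 ≤ t) (ht : ∀ j, 2 * (t * b j) < 1)
    (hint : Integrable (fun ω => Real.exp (t * Z ω)) P) {g : ι → ℝ} {B : ℝ}
    (hg : ∀ j, g j ≤ logMGF (t * b j) (m j)) (hB : HasSum g B) :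
    Real.exp B ≤ mgf Z P t := by
  have partial_le (s : Finset ι) : Real.exp (∑ j ∈ s, g j - t * (∑' j, b j - ∑ j ∈ s, b j)) ≤
      mgf Z P t := by
    have hpoint : (fun ω => ∑ j ∈ s, b j * (Y j ω ^ 2 - 1) + -(∑' j, b j - ∑ j ∈ s, b j)) ≤ᵐ[P]
        Z := by
      filter_upwards [h.ae_hasSum] with ω hω
      have hsum_le := sum_le_hasSum s (fun j _ => mul_nonneg (h.nonneg j) (sq_nonneg (Y j ω)))
        ((hω.add h.summable.hasSum).congr_fun fun j => by ring)
      simp only [mul_sub, Finset.sum_sub_distrib, mul_one]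
      linarith
    refine le_trans ?_ (mgf_mono_of_nonneg hpoint ht₀ hint)
    rw [mgf_add_const, (h.integrable_exp_and_mgf_sum ht s).2, ← Real.exp_add, sub_eq_add_neg,
      mul_neg]
    gcongr with j
    exact hg j
  have hlim : Tendsto (fun s : Finset ι => ∑ j ∈ s, g j - t * (∑' j, b j - ∑ j ∈ s, b j)) atTop
      (𝓝 B) := by
    simpa using Tendsto.sub hB
      ((tendsto_const_nhds (x := ∑' j, b j)).sub h.summable.hasSum |>.const_mul t)
  exact le_of_tendsto' ((Real.continuous_exp.tendsto B).comp hlim) partial_le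

lemma hasSum_logMGF_majorant (h : IsChiSquareSum Y m b Z P) (t c : ℝ) :
    HasSum (fun j => 2 * (t * b j) ^ 2 + c * (t * b j * m j ^ 2))
      (2 * t ^ 2 * ∑' j, b j ^ 2 + c * t * ∑' j, b j * m j ^ 2) := by
  refine (((summable_sq_of_nonneg h.nonneg h.summable).hasSum.mul_left (2 * t ^ 2)).add
    (h.summable_mul_sq.hasSum.mul_left (c * t))).congr_fun fun j => ?_
  ring

lemma integrable_exp_and_mgf_le_of_nonneg [Countable ι] (h : IsChiSquareSum Y m b Z P)
    (ht₀ : 0 ≤ t) (ht : ∀ j, t * b j ≤ 1 / 8) :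
    Integrable (fun ω => Real.exp (t * Z ω)) P ∧
      mgf Z P t ≤ Real.exp (2 * t ^ 2 * ∑' j, b j ^ 2 + 2 * t * ∑' j, b j * m j ^ 2) :=
  h.integrable_exp_and_mgf_le (fun j => by linarith [ht j])
    (fun j => logMGF_le_of_nonneg (mul_nonneg ht₀ (h.nonneg j)) (ht j) _)
    (h.hasSum_logMGF_majorant t 2)

lemma integrable_exp_and_mgf_neg_le_of_nonneg [Countable ι] (h : IsChiSquareSum Y m b Z P)
    (ht₀ : 0 ≤ t) (ht : ∀ j, t * b j ≤ 1 / 8) :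
    Integrable (fun ω => Real.exp (-t * Z ω)) P ∧
      mgf Z P (-t) ≤ Real.exp (2 * t ^ 2 * ∑' j, b j ^ 2 - t / 2 * ∑' j, b j * m j ^ 2) := by
  have htb (j : ι) : 0 ≤ t * b j := mul_nonneg ht₀ (h.nonneg j)
  convert h.integrable_exp_and_mgf_le (t := -t) (fun j => by linarith [htb j])
    (fun j => logMGF_le_of_nonpos (by linarith [htb j]) (by linarith [ht j]) _)
    (h.hasSum_logMGF_majorant (-t) (1 / 2)) using 3
  ring

lemma exp_le_mgf_of_mean_zero [Countable ι] (h : IsChiSquareSum Y 0 b Z P) (ht₀ : 0 ≤ t)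
    (ht : ∀ j, t * b j ≤ 1 / 8) : Real.exp (t ^ 2 / 3 * ∑' j, b j ^ 2) ≤ mgf Z P t := by
  have htb (j : ι) : 0 ≤ t * b j := mul_nonneg ht₀ (h.nonneg j)
  refine h.exp_le_mgf ht₀ (fun j => by linarith [ht j])
    (h.integrable_exp_and_mgf_le_of_nonneg ht₀ ht).1 (fun j => ?_)
    ((summable_sq_of_nonneg h.nonneg h.summable).hasSum.mul_left (t ^ 2 / 3))
  refine le_trans (le_of_eq (by ring)) (sq_div_three_le_logMGF_zero (x := t * b j) ?_)
  rw [abs_of_nonneg (htb j)]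
  exact ht j

lemma measureReal_lt_le [Countable ι] (h : IsChiSquareSum Y m b Z P) (ht₀ : 0 ≤ t)
    (ht : ∀ j, t * b j ≤ 1 / 8) (u : ℝ) :
    P.real {ω | u < Z ω} ≤
      Real.exp (2 * t ^ 2 * ∑' j, b j ^ 2 + 2 * t * ∑' j, b j * m j ^ 2 - t * u) := by
  have := h.indep.isProbabilityMeasure
  obtain ⟨hint, hmgf⟩ := h.integrable_exp_and_mgf_le_of_nonneg ht₀ ht
  calc P.real {ω | u < Z ω} ≤ P.real {ω | u ≤ Z ω} :=
        measureReal_mono fun ω (hω : u < Z ω) => hω.le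
    _ ≤ Real.exp (-t * u) * mgf Z P t := measure_ge_le_exp_mul_mgf u ht₀ hint
    _ ≤ Real.exp (-t * u) * _ := mul_le_mul_of_nonneg_left hmgf (Real.exp_pos _).le
    _ = _ := by rw [← Real.exp_add]; congr 1; ring

lemma measureReal_le_le [Countable ι] (h : IsChiSquareSum Y m b Z P) (ht₀ : 0 ≤ t)
    (ht : ∀ j, t * b j ≤ 1 / 8) (u : ℝ) :
    P.real {ω | Z ω ≤ u} ≤
      Real.exp (2 * t ^ 2 * ∑' j, b j ^ 2 - t / 2 * ∑' j, b j * m j ^ 2 + t * u) := by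
  have := h.indep.isProbabilityMeasure
  obtain ⟨hint, hmgf⟩ := h.integrable_exp_and_mgf_neg_le_of_nonneg ht₀ ht
  calc P.real {ω | Z ω ≤ u} ≤ Real.exp (-(-t) * u) * mgf Z P (-t) :=
        measure_le_le_exp_mul_mgf u (neg_nonpos.2 ht₀) hint
    _ ≤ Real.exp (-(-t) * u) * _ := mul_le_mul_of_nonneg_left hmgf (Real.exp_pos _).le
    _ = _ := by rw [← Real.exp_add]; congr 1; ring

lemma exp_le_measureReal_lt_of_mean_zero [Countable ι] (h : IsChiSquareSum Y 0 b Z P) {A : ℝ}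
    (hA₀ : 0 < A) (hA : ∑' j, b j ^ 2 = A) (hu₀ : 0 ≤ u) (hu : ∀ j, 12 * u / A * b j ≤ 1 / 8)
    (hu₁ : 1 / 2 ≤ u ^ 2 / A) :
    Real.exp (-288 * (u ^ 2 / A)) ≤ P.real {ω | u < Z ω} := by
  have := h.indep.isProbabilityMeasure
  set v := u ^ 2 / A with hv
  have ht₀ : 0 ≤ 6 * u / A := by positivity
  have h2t (j : ι) : 2 * (6 * u / A) * b j ≤ 1 / 8 := (le_of_eq (by ring)).trans (hu j)
  have h1t (j : ι) : 6 * u / A * b j ≤ 1 / 8 := by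
    have := mul_nonneg ht₀ (h.nonneg j)
    linarith [h2t j]
  have lower : Real.exp (12 * v) ≤ mgf Z P (6 * u / A) := by
    convert h.exp_le_mgf_of_mean_zero ht₀ h1t using 2
    rw [hA, hv]
    field_simp
    ring
  obtain ⟨hint, hmgf⟩ := h.integrable_exp_and_mgf_le_of_nonneg (mul_nonneg zero_le_two ht₀) h2t
  have upper : √(mgf Z P (2 * (6 * u / A))) ≤ Real.exp (144 * v) := by
    refine Real.sqrt_le_iff.2 ⟨(Real.exp_pos _).le, hmgf.trans (le_of_eq ?_)⟩
    rw [hA, hv, ← Real.exp_nat_mul]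
    simp only [Pi.zero_apply]
    congr 1
    field_simp
    norm_num
    ring
  have htu : 6 * u / A * u = 6 * v := by rw [hv]; ring
  refine exp_neg_le_of_exp_le_add_mul_sqrt hu₁ ((lower.trans
    (mgf_le_exp_add_sqrt_mgf_mul_sqrt_measureReal ht₀ h.aemeasurable hint u)).trans ?_)
  rw [htu]
  gcongr

end IsChiSquareSum

end ChiSquareSum

section Model

variable {φ : ℕ+ → L2} {ϰ : ℕ+ → ℝ} {ε τ : ℝ}

/-- `A_ε(S) = ε⁻⁴ ∑_j ϰ_j² θ_j²`: up to a factor of order one, the shift in the mean of the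
normalized statistic `ε⁻² T_ε` under the alternative `S`. -/
def signal (φ : ℕ+ → L2) (ϰ : ℕ+ → ℝ) (ε : ℝ) (S : L2) : ℝ :=
  ε⁻¹ ^ 4 * ∑' j, ϰ j ^ 2 * coeff φ S j ^ 2

/-- The threshold `ε⁻² A_ε^{1/2} x` for the normalized statistic `ε⁻² T_ε` which corresponds to
the threshold `x` for `A_ε^{-1/2} T_ε`. -/
def scaledThreshold (ϰ : ℕ+ → ℝ) (ε x : ℝ) : ℝ := ε⁻¹ ^ 2 * (√(bigA ϰ ε) * x)

lemma signal_nonneg (φ : ℕ+ → L2) (ϰ : ℕ+ → ℝ) (ε : ℝ) (S : L2) : 0 ≤ signal φ ϰ ε S :=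
  mul_nonneg (by positivity) (tsum_nonneg fun j => by positivity)

lemma coeff_sq_le (hφ : Orthonormal ℝ φ) (S : L2) (j : ℕ+) : coeff φ S j ^ 2 ≤ ‖S‖ ^ 2 := by
  have h := abs_real_inner_le_norm (φ j) S
  rw [hφ.1 j, one_mul] at h
  exact sq_le_sq' (abs_le.1 h).1 (abs_le.1 h).2

lemma summable_mul_coeff_sq (hφ : Orthonormal ℝ φ) (hϰ : Summable fun j => ϰ j ^ 2) (S : L2) :
    Summable fun j => ϰ j ^ 2 * coeff φ S j ^ 2 :=
  (hϰ.mul_right (‖S‖ ^ 2)).of_nonneg_of_le (fun j => by positivity) fun j =>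
    mul_le_mul_of_nonneg_left (coeff_sq_le hφ S j) (sq_nonneg _)

instance isProbabilityMeasure_obsLaw (φ : ℕ+ → L2) (ε : ℝ) (S : L2) :
    IsProbabilityMeasure (obsLaw φ ε S) := by
  unfold obsLaw
  infer_instance

lemma hasLaw_obsLaw_div (φ : ℕ+ → L2) (hε : 0 < ε) (S : L2) (j : ℕ+) :
    HasLaw (fun y : ℕ+ → ℝ => y j / ε) (gaussianReal (coeff φ S j / ε) 1) (obsLaw φ ε S) := by
  have hcoord : HasLaw (fun y : ℕ+ → ℝ => y j)
      (gaussianReal (coeff φ S j) (ε ^ 2).toNNReal) (obsLaw φ ε S) :=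
    ⟨(measurable_pi_apply j).aemeasurable, Measure.infinitePi_map_eval _ j⟩
  have hvar : (ε ^ 2).toNNReal / .mk (ε ^ 2) (sq_nonneg ε) = 1 := by
    rw [Real.toNNReal_of_nonneg (sq_nonneg ε)]
    exact div_self (NNReal.coe_ne_zero.1 (pow_ne_zero 2 hε.ne'))
  simpa only [hvar] using gaussianReal_div_const hcoord ε

lemma isChiSquareSum_stat (hφ : Orthonormal ℝ φ) (hϰ : Summable fun j => ϰ j ^ 2) (hε : 0 < ε)
    (S : L2) :
    IsChiSquareSum (fun j y => y j / ε) (fun j => coeff φ S j / ε) (fun j => ε⁻¹ ^ 2 * ϰ j ^ 2)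
      (fun y => ε⁻¹ ^ 2 * stat ϰ ε y) (obsLaw φ ε S) := by
  have hnonneg (j : ℕ+) : 0 ≤ ε⁻¹ ^ 2 * ϰ j ^ 2 := by positivity
  have hsignal : Summable fun j => ε⁻¹ ^ 2 * ϰ j ^ 2 * (coeff φ S j / ε) ^ 2 :=
    ((summable_mul_coeff_sq hφ hϰ S).mul_left (ε⁻¹ ^ 4)).congr fun j => by ring
  refine ⟨hasLaw_obsLaw_div φ hε S, ?_, hnonneg, hϰ.mul_left _, hsignal, ?_⟩
  · exact iIndepFun_infinitePi (X := fun _ z => z / ε) fun _ => by fun_prop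
  · filter_upwards [ae_summable_mul_sq (hasLaw_obsLaw_div φ hε S) hnonneg (hϰ.mul_left _) hsignal]
      with y hy
    have hy' : Summable fun j => ϰ j ^ 2 * y j ^ 2 :=
      (hy.mul_left (ε ^ 4)).congr fun j => by field_simp
    refine (((hy'.hasSum.mul_left (ε⁻¹ ^ 2)).sub hϰ.hasSum).mul_left (ε⁻¹ ^ 2)).congr_fun ?_
    exact fun j => by ring

lemma tsum_weight_sq (ϰ : ℕ+ → ℝ) (ε : ℝ) : ∑' j, (ε⁻¹ ^ 2 * ϰ j ^ 2) ^ 2 = bigA ϰ ε := by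
  rw [bigA, ← tsum_mul_left]
  exact tsum_congr fun j => by ring

lemma tsum_weight_mul_mean_sq (φ : ℕ+ → L2) (ϰ : ℕ+ → ℝ) (ε : ℝ) (S : L2) :
    ∑' j, ε⁻¹ ^ 2 * ϰ j ^ 2 * (coeff φ S j / ε) ^ 2 = signal φ ϰ ε S := by
  rw [signal, ← tsum_mul_left]
  exact tsum_congr fun j => by ring

lemma mem_rejectRegion_iff (hε : 0 < ε) (hA : 0 < bigA ϰ ε) (x : ℝ) (y : ℕ+ → ℝ) :
    y ∈ rejectRegion ϰ ε x ↔ scaledThreshold ϰ ε x < ε⁻¹ ^ 2 * stat ϰ ε y := by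
  rw [rejectRegion, Set.mem_ofPred_eq, scaledThreshold, mul_lt_mul_iff_right₀ (by positivity),
    Real.rpow_neg hA.le, ← Real.sqrt_eq_rpow, inv_mul_eq_div, lt_div_iff₀' (Real.sqrt_pos.2 hA)]

lemma scaledThreshold_div_sqrt (hε : 0 < ε) (hA : 0 < bigA ϰ ε) (u : ℝ) :
    scaledThreshold ϰ ε (ε ^ 2 * u / √(bigA ϰ ε)) = u := by
  have := (Real.sqrt_pos.2 hA).ne'
  rw [scaledThreshold]
  field_simp

lemma isChiSquareSum_stat_null (hφ : Orthonormal ℝ φ) (hϰ : Summable fun j => ϰ j ^ 2)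
    (hε : 0 < ε) :
    IsChiSquareSum (fun j y => y j / ε) 0 (fun j => ε⁻¹ ^ 2 * ϰ j ^ 2)
      (fun y => ε⁻¹ ^ 2 * stat ϰ ε y) (obsLaw φ ε 0) := by
  have hmean : (fun j => coeff φ 0 j / ε) = 0 := by
    ext j
    simp [coeff]
  simpa only [hmean] using isChiSquareSum_stat hφ hϰ hε 0

lemma typeI_eq (φ : ℕ+ → L2) (hε : 0 < ε) (hA : 0 < bigA ϰ ε) (x : ℝ) :
    typeI φ ϰ ε x =
      (obsLaw φ ε 0).real {y | scaledThreshold ϰ ε x < ε⁻¹ ^ 2 * stat ϰ ε y} := by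
  rw [typeI]
  congr 1
  ext y
  exact mem_rejectRegion_iff hε hA x y

lemma typeII_eq (φ : ℕ+ → L2) (hε : 0 < ε) (hA : 0 < bigA ϰ ε) (x : ℝ) (S : L2) :
    typeII φ ϰ ε x S =
      (obsLaw φ ε S).real {y | ε⁻¹ ^ 2 * stat ϰ ε y ≤ scaledThreshold ϰ ε x} := by
  rw [typeII]
  congr 1
  ext y
  rw [Set.mem_compl_iff, mem_rejectRegion_iff hε hA, not_lt, Set.mem_ofPred_eq]

lemma typeI_le (hφ : Orthonormal ℝ φ) (hϰ : Summable fun j => ϰ j ^ 2) (hε : 0 < ε)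
    (hA : 0 < bigA ϰ ε) (hτ₀ : 0 ≤ τ) (hτ : ∀ j, τ * (ε⁻¹ ^ 2 * ϰ j ^ 2) ≤ 1 / 8) (x : ℝ) :
    typeI φ ϰ ε x ≤ Real.exp (2 * τ ^ 2 * bigA ϰ ε - τ * scaledThreshold ϰ ε x) := by
  rw [typeI_eq φ hε hA, ← tsum_weight_sq]
  simpa using
    (isChiSquareSum_stat_null hφ hϰ hε).measureReal_lt_le hτ₀ hτ (scaledThreshold ϰ ε x)

lemma typeII_le (hφ : Orthonormal ℝ φ) (hϰ : Summable fun j => ϰ j ^ 2) (hε : 0 < ε)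
    (hA : 0 < bigA ϰ ε) (hτ₀ : 0 ≤ τ) (hτ : ∀ j, τ * (ε⁻¹ ^ 2 * ϰ j ^ 2) ≤ 1 / 8) (x : ℝ)
    (S : L2) :
    typeII φ ϰ ε x S ≤ Real.exp
      (2 * τ ^ 2 * bigA ϰ ε - τ / 2 * signal φ ϰ ε S + τ * scaledThreshold ϰ ε x) := by
  rw [typeII_eq φ hε hA, ← tsum_weight_sq, ← tsum_weight_mul_mean_sq]
  exact (isChiSquareSum_stat hφ hϰ hε S).measureReal_le_le hτ₀ hτ _

lemma half_le_typeII (hφ : Orthonormal ℝ φ) (hϰ : Summable fun j => ϰ j ^ 2) (hε : 0 < ε)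
    (hA : 0 < bigA ϰ ε) (hweight : ∀ j, ε⁻¹ ^ 2 * ϰ j ^ 2 ≤ 1 / 8) {x : ℝ} {S : L2}
    (hx : 2 * bigA ϰ ε + 2 * signal φ ϰ ε S + 1 ≤ scaledThreshold ϰ ε x) :
    1 / 2 ≤ typeII φ ϰ ε x S := by
  have h := isChiSquareSum_stat hφ hϰ hε S
  have hreject : (obsLaw φ ε S).real {y | scaledThreshold ϰ ε x < ε⁻¹ ^ 2 * stat ϰ ε y} ≤
      1 / 2 := calc
    _ ≤ Real.exp (2 * 1 ^ 2 * bigA ϰ ε + 2 * 1 * signal φ ϰ ε S - 1 * scaledThreshold ϰ ε x) := by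
      rw [← tsum_weight_sq, ← tsum_weight_mul_mean_sq]
      exact h.measureReal_lt_le zero_le_one (by simpa only [one_mul] using hweight) _
    _ ≤ Real.exp (-1) := Real.exp_le_exp.2 (by linarith)
    _ ≤ 1 / 2 := by
      rw [Real.exp_neg, one_div]
      exact inv_anti₀ two_pos (by linarith [Real.add_one_le_exp 1])
  have hcompl : {y | ε⁻¹ ^ 2 * stat ϰ ε y ≤ scaledThreshold ϰ ε x} =
      {y | scaledThreshold ϰ ε x < ε⁻¹ ^ 2 * stat ϰ ε y}ᶜ := by
    ext y
    simp
  rw [typeII_eq φ hε hA, hcompl,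
    probReal_compl_eq_one_sub₀ (nullMeasurableSet_lt aemeasurable_const h.aemeasurable)]
  linarith

lemma exp_le_typeI (hφ : Orthonormal ℝ φ) (hϰ : Summable fun j => ϰ j ^ 2) (hε : 0 < ε)
    (hA : 0 < bigA ϰ ε) {x : ℝ} (hx₀ : 0 ≤ scaledThreshold ϰ ε x)
    (hx : ∀ j, 12 * scaledThreshold ϰ ε x / bigA ϰ ε * (ε⁻¹ ^ 2 * ϰ j ^ 2) ≤ 1 / 8)
    (hxA : bigA ϰ ε ≤ 2 * scaledThreshold ϰ ε x ^ 2) :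
    Real.exp (-288 * (scaledThreshold ϰ ε x ^ 2 / bigA ϰ ε)) ≤ typeI φ ϰ ε x := by
  rw [typeI_eq φ hε hA]
  refine (isChiSquareSum_stat_null hφ hϰ hε).exp_le_measureReal_lt_of_mean_zero hA
    (tsum_weight_sq ϰ ε) hx₀ hx ?_
  rw [le_div_iff₀ hA]
  linarith

end Model

section LargeDeviations

/-- The normalized weights `ε⁻² ϰ_{εj}²` are `o(1 / R ε)`, uniformly in `j`, so that the Chernoff
bounds are available with the tilting parameter of order `R ε` needed at the scale `R ε ^ 2`. -/
def WeightsNegligible (ϰ : ℝ → ℕ+ → ℝ) (R : ℝ → ℝ) : Prop :=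
  ∀ η : ℝ, 0 < η → ∀ᶠ ε in 𝓝[>] (0 : ℝ), ∀ j, R ε * (ε⁻¹ ^ 2 * ϰ ε j ^ 2) ≤ η

variable {φ : ℕ+ → L2} {ϰ : ℝ → ℕ+ → ℝ} {R : ℝ → ℝ} {ι : Type} {l : Filter ι} {e : ι → ℝ}
  {S : ι → L2} {x : ι → ℝ}

lemma WeightsNegligible.eventually_mul_le (hK : WeightsNegligible ϰ R)
    (he : Tendsto e l (𝓝[>] 0)) {m η : ℝ} (hm : 0 < m) (hη : 0 < η) :
    ∀ᶠ i in l, ∀ j, m * R (e i) * ((e i)⁻¹ ^ 2 * ϰ (e i) j ^ 2) ≤ η := by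
  filter_upwards [he.eventually (hK (η / m) (div_pos hη hm))] with i hi j
  have := (le_div_iff₀' hm).1 (hi j)
  linarith

lemma eventually_scaledThreshold_le (hφ : Orthonormal ℝ φ)
    (hsum : ∀ ε, 0 < ε → Summable fun j => ϰ ε j ^ 2) (hA2 : CondA2 ϰ)
    (hR : ∀ᶠ ε in 𝓝[>] 0, 0 < R ε) (hK : WeightsNegligible ϰ R) (he : Tendsto e l (𝓝[>] 0))
    (hα : ∀ᶠ i in l, 0 < typeI φ (ϰ (e i)) (e i) (x i))
    (hlog : Tendsto (fun i => Real.log (typeI φ (ϰ (e i)) (e i) (x i)) / R (e i) ^ 2) l (𝓝 0))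
    {η : ℝ} (hη : 0 < η) :
    ∀ᶠ i in l, scaledThreshold (ϰ (e i)) (e i) (x i) ≤ η * R (e i) := by
  obtain ⟨C₁, C₂, hC₁, hC₂, hA⟩ := hA2
  set m := η / (4 * C₂) with hm
  have hm₀ : 0 < m := by positivity
  filter_upwards [he.eventually self_mem_nhdsWithin, he.eventually hR, hα,
    hK.eventually_mul_le he hm₀ (η := 1 / 8) (by norm_num),
    hlog.eventually_const_lt (u := -(m * η / 2)) (neg_neg_of_pos (by positivity))]
    with i (hε : 0 < e i) hR hα hτ hlog
  obtain ⟨hA₁, hA₂⟩ := hA _ hε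
  have hτ₀ : 0 < m * R (e i) := mul_pos hm₀ hR
  have hchernoff := (Real.log_le_iff_le_exp hα).2
    (typeI_le hφ (hsum _ hε) hε (hC₁.trans hA₁) hτ₀.le hτ (x i))
  have hvar : 2 * (m * R (e i)) ^ 2 * bigA (ϰ (e i)) (e i) ≤ m * η / 2 * R (e i) ^ 2 := calc
    _ ≤ 2 * (m * R (e i)) ^ 2 * C₂ := by gcongr
    _ = m * η / 2 * R (e i) ^ 2 := by rw [hm]; field_simp; ring
  rw [lt_div_iff₀ (by positivity)] at hlog
  refine le_of_mul_le_mul_left ?_ hτ₀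
  linarith

lemma ldConsistentAlong_of_eventually_mul_le_signal (hφ : Orthonormal ℝ φ)
    (hsum : ∀ ε, 0 < ε → Summable fun j => ϰ ε j ^ 2) (hA2 : CondA2 ϰ)
    (hR : ∀ᶠ ε in 𝓝[>] 0, 0 < R ε) (hK : WeightsNegligible ϰ R) (he : Tendsto e l (𝓝[>] 0))
    {c : ℝ} (hc : 0 < c) (hS : ∀ᶠ i in l, c * R (e i) ≤ signal φ (ϰ (e i)) (e i) (S i)) :
    LDConsistentAlong φ ϰ R l e S := by
  intro x hα hlog
  have hthreshold := eventually_scaledThreshold_le hφ hsum hA2 hR hK he hα hlog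
    (η := c / 8) (by positivity)
  obtain ⟨C₁, C₂, hC₁, hC₂, hA⟩ := hA2
  set m := c / (16 * C₂) with hm
  have hm₀ : 0 < m := by positivity
  refine ⟨4 / (m * c), by positivity, ?_⟩
  filter_upwards [he.eventually self_mem_nhdsWithin, he.eventually hR, hthreshold, hS,
    hK.eventually_mul_le he hm₀ (η := 1 / 8) (by norm_num)] with i (hε : 0 < e i) hR hu hS hτ
  obtain ⟨hA₁, hA₂⟩ := hA _ hε
  have hτ₀ : 0 < m * R (e i) := mul_pos hm₀ hR
  have hβ₀ : 0 ≤ typeII φ (ϰ (e i)) (e i) (x i) (S i) := measureReal_nonneg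
  rcases hβ₀.eq_or_lt' with hβ | hβ
  · exact Or.inl hβ
  have hchernoff := (Real.log_le_iff_le_exp hβ).2
    (typeII_le hφ (hsum _ hε) hε (hC₁.trans hA₁) hτ₀.le hτ (x i) (S i))
  have hvar : 2 * (m * R (e i)) ^ 2 * bigA (ϰ (e i)) (e i) ≤ m * c / 8 * R (e i) ^ 2 := calc
    _ ≤ 2 * (m * R (e i)) ^ 2 * C₂ := by gcongr
    _ = m * c / 8 * R (e i) ^ 2 := by rw [hm]; field_simp; ring
  have hlog_le : Real.log (typeII φ (ϰ (e i)) (e i) (x i) (S i)) ≤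
      -(m * c / 4 * R (e i) ^ 2) := by
    have := mul_le_mul_of_nonneg_left hu hτ₀.le
    have := mul_le_mul_of_nonneg_left hS hτ₀.le
    linarith
  right
  rw [div_mul_eq_mul_div, le_div_iff₀ (by positivity)]
  linarith [neg_le_abs (Real.log (typeII φ (ϰ (e i)) (e i) (x i) (S i)))]

lemma not_ldConsistentAlong_of_half_le_typeII [l.NeBot] (hR : Tendsto (fun i => R (e i)) l atTop)
    (hα : ∀ᶠ i in l, 0 < typeI φ (ϰ (e i)) (e i) (x i))
    (hlog : Tendsto (fun i => Real.log (typeI φ (ϰ (e i)) (e i) (x i)) / R (e i) ^ 2) l (𝓝 0))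
    (hβ : ∀ᶠ i in l, 1 / 2 ≤ typeII φ (ϰ (e i)) (e i) (x i) (S i)) :
    ¬ LDConsistentAlong φ ϰ R l e S := by
  intro h
  obtain ⟨C, hC, hC'⟩ := h x hα hlog
  obtain ⟨i, hi, hβ, hbig⟩ := (hC'.and (hβ.and
    (((tendsto_pow_atTop two_ne_zero).comp hR).eventually_gt_atTop (C * Real.log 2)))).exists
  have hβ₀ : 0 < typeII φ (ϰ (e i)) (e i) (x i) (S i) := one_half_pos.trans_le hβ
  have hlog_ge : -Real.log 2 ≤ Real.log (typeII φ (ϰ (e i)) (e i) (x i) (S i)) := by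
    rw [← Real.log_inv, ← one_div]
    exact Real.log_le_log one_half_pos hβ
  refine (hi.resolve_left hβ₀.ne').not_gt ((mul_le_mul_of_nonneg_left ?_ hC.le).trans_lt hbig)
  rw [abs_of_nonpos (Real.log_nonpos hβ₀.le measureReal_le_one)]
  linarith

lemma eventually_typeI_pos_and_tendsto_log_typeI (hφ : Orthonormal ℝ φ)
    (hsum : ∀ ε, 0 < ε → Summable fun j => ϰ ε j ^ 2) (hA2 : CondA2 ϰ)
    (hR : ∀ᶠ ε in 𝓝[>] 0, 0 < R ε) (hK : WeightsNegligible ϰ R) (he : Tendsto e l (𝓝[>] 0))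
    (hx : ∀ᶠ i in l, √(bigA (ϰ (e i)) (e i)) ≤ scaledThreshold (ϰ (e i)) (e i) (x i))
    (hxR : Tendsto (fun i => scaledThreshold (ϰ (e i)) (e i) (x i) / R (e i)) l (𝓝 0)) :
    (∀ᶠ i in l, 0 < typeI φ (ϰ (e i)) (e i) (x i)) ∧
      Tendsto (fun i => Real.log (typeI φ (ϰ (e i)) (e i) (x i)) / R (e i) ^ 2) l (𝓝 0) := by
  obtain ⟨C₁, C₂, hC₁, -, hA⟩ := hA2
  have lower : ∀ᶠ i in l,
      Real.exp (-(288 / C₁) * (scaledThreshold (ϰ (e i)) (e i) (x i) / R (e i)) ^ 2 * R (e i) ^ 2) ≤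
        typeI φ (ϰ (e i)) (e i) (x i) := by
    filter_upwards [he.eventually self_mem_nhdsWithin, he.eventually hR, hx,
      hK.eventually_mul_le he (div_pos (by norm_num : (0 : ℝ) < 12) hC₁) (η := 1 / 8)
        (by norm_num), hxR.eventually_le_const one_pos] with i (hε : 0 < e i) hR hx hτ hxR
    have hA₁ := (hA _ hε).1
    have hA₀ := hC₁.trans hA₁
    generalize hu : scaledThreshold (ϰ (e i)) (e i) (x i) = u at *
    have hu₀ : 0 ≤ u := (Real.sqrt_nonneg _).trans hx
    rw [div_le_one hR] at hxR
    refine le_trans ?_ (exp_le_typeI hφ (hsum _ hε) hε hA₀ (by rwa [hu]) (fun j => ?_) ?_)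
    · rw [hu, Real.exp_le_exp, neg_mul, neg_mul, neg_mul, neg_le_neg_iff, mul_assoc, ← mul_pow,
        div_mul_cancel₀ _ hR.ne', div_mul_eq_mul_div, ← mul_div_assoc]
      gcongr
    · rw [hu]
      refine le_trans ?_ (hτ j)
      rw [div_mul_eq_mul_div 12]
      gcongr
    · rw [hu]
      have := (Real.sqrt_le_left hu₀).1 hx
      linarith [sq_nonneg u]
  have hα := lower.mono fun i hi => (Real.exp_pos _).trans_le hi
  refine ⟨hα, ?_⟩
  have hlim : Tendsto (fun i => -(288 / C₁) *
      (scaledThreshold (ϰ (e i)) (e i) (x i) / R (e i)) ^ 2) l (𝓝 0) := by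
    simpa using (hxR.pow 2).const_mul (-(288 / C₁))
  refine tendsto_of_tendsto_of_tendsto_of_le_of_le' hlim tendsto_const_nhds ?_ ?_
  · filter_upwards [lower, hα, he.eventually hR] with i hi hα hR
    rw [le_div_iff₀ (pow_pos hR 2)]
    exact (Real.le_log_iff_exp_le hα).2 hi
  · exact hα.mono fun i hα => div_nonpos_of_nonpos_of_nonneg
      (Real.log_nonpos hα.le measureReal_le_one) (sq_nonneg _)

lemma not_ldConsistentAlong_of_tendsto_signal [l.NeBot] (hφ : Orthonormal ℝ φ)
    (hsum : ∀ ε, 0 < ε → Summable fun j => ϰ ε j ^ 2) (hA2 : CondA2 ϰ)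
    (hR : Tendsto R (𝓝[>] 0) atTop) (hK : WeightsNegligible ϰ R) (he : Tendsto e l (𝓝[>] 0))
    (hS : Tendsto (fun i => signal φ (ϰ (e i)) (e i) (S i) / R (e i)) l (𝓝 0)) :
    ¬ LDConsistentAlong φ ϰ R l e S := by
  obtain ⟨C₁, C₂, hC₁, hC₂, hA⟩ := id hA2
  have hRe : Tendsto (fun i => R (e i)) l atTop := hR.comp he
  set u : ι → ℝ := fun i => 2 * signal φ (ϰ (e i)) (e i) (S i) + (2 * C₂ + 1)
  set x : ι → ℝ := fun i => e i ^ 2 * u i / √(bigA (ϰ (e i)) (e i))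
  have hε : ∀ᶠ i in l, 0 < e i := he.eventually self_mem_nhdsWithin
  have hx : ∀ᶠ i in l, scaledThreshold (ϰ (e i)) (e i) (x i) = u i :=
    hε.mono fun i hε => scaledThreshold_div_sqrt hε (hC₁.trans (hA _ hε).1) _
  have hu : Tendsto (fun i => u i / R (e i)) l (𝓝 0) := by
    simpa [u, add_div, mul_div_assoc] using
      (hS.const_mul 2).add (hRe.const_div_atTop (2 * C₂ + 1))
  have hxR : Tendsto (fun i => scaledThreshold (ϰ (e i)) (e i) (x i) / R (e i)) l (𝓝 0) :=
    hu.congr' (hx.mono fun i hi => by simp only [hi])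
  have hxA : ∀ᶠ i in l, √(bigA (ϰ (e i)) (e i)) ≤ scaledThreshold (ϰ (e i)) (e i) (x i) := by
    filter_upwards [hε, hx] with i hε hx
    have : C₂ + 1 ≤ u i := by
      simp only [u]
      linarith [signal_nonneg φ (ϰ (e i)) (e i) (S i)]
    rw [hx, Real.sqrt_le_left (by linarith)]
    nlinarith [(hA _ hε).2]
  obtain ⟨hα, hlog⟩ := eventually_typeI_pos_and_tendsto_log_typeI hφ hsum hA2
    (hR.eventually_gt_atTop 0) hK he hxA hxR
  refine not_ldConsistentAlong_of_half_le_typeII hRe hα hlog ?_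
  filter_upwards [hε, hx, hRe.eventually_ge_atTop 1,
    hK.eventually_mul_le he one_pos (η := 1 / 8) (by norm_num)] with i hε hx hR hτ
  obtain ⟨hA₁, hA₂⟩ := hA _ hε
  refine half_le_typeII hφ (hsum _ hε) hε (hC₁.trans hA₁) (fun j => ?_) ?_
  · refine (le_mul_of_one_le_left (by positivity) ?_).trans (hτ j)
    rwa [one_mul]
  · rw [hx]
    simp only [u]
    linarith

end LargeDeviations

section Cutoff

variable {ϰ : ℕ+ → ℝ}

lemma sqAt_coe (ϰ : ℕ+ → ℝ) (k : ℕ+) : sqAt ϰ k = ϰ k ^ 2 := by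
  simp [sqAt]

lemma card_Iic_pnat (k : ℕ+) : (Finset.Iic k).card = (k : ℕ) := by
  have hIcc : Finset.Iic k = Finset.Icc 1 k := by
    ext j
    simp
  rw [hIcc, PNat.card_Icc, PNat.one_coe, Nat.add_sub_cancel]

lemma exists_cutoff_eq (hϰ : Summable fun j => ϰ j ^ 2) (hρ : 0 < rhoSq ϰ) :
    ∃ k : ℕ+, cutoff ϰ = k ∧ rhoSq ϰ / 2 < ∑ j ∈ Finset.Iic k, ϰ j ^ 2 := by
  set K : Set ℕ+ := {k : ℕ+ | ∑ j ∈ Finset.Iio k, ϰ j ^ 2 ≤ rhoSq ϰ / 2}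
  obtain ⟨s, hs⟩ := (hϰ.hasSum.eventually (lt_mem_nhds (half_lt_self hρ))).exists_forall_of_atTop
  have hbdd : BddAbove ((fun k : ℕ+ => (k : ℕ)) '' K) := by
    refine ⟨s.sup fun j : ℕ+ => (j : ℕ), ?_⟩
    rintro _ ⟨k, hk, rfl⟩
    by_contra! hlt
    refine absurd hk (not_le.2 (hs (Finset.Iio k) fun j hj => ?_))
    rw [Finset.mem_Iio, ← PNat.coe_lt_coe]
    exact (Finset.le_sup (f := fun j : ℕ+ => (j : ℕ)) hj).trans_lt hlt
  have hone : (1 : ℕ+) ∈ K := by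
    have hempty : Finset.Iio (1 : ℕ+) = ∅ := by ext j; simp
    simp only [K, Set.mem_ofPred_eq, hempty, Finset.sum_empty]
    exact (half_pos hρ).le
  obtain ⟨k, -, hk⟩ := Nat.sSup_mem (Set.Nonempty.image _ ⟨1, hone⟩) hbdd
  refine ⟨k, hk.symm, ?_⟩
  by_contra! hle
  have hsucc : Finset.Iio (k + 1) = Finset.Iic k := by
    ext j
    simp
  have hmem : k + 1 ∈ K := by rwa [Set.mem_ofPred_eq, hsucc]
  have := (le_csSup hbdd ⟨k + 1, hmem, rfl⟩).trans_eq hk.symm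
  simp at this

lemma rhoSq_pos {ε : ℝ} (hϰ : Summable fun j => ϰ j ^ 2) (hA : 0 < bigA ϰ ε) :
    0 < rhoSq ϰ := by
  refine (tsum_nonneg fun j => sq_nonneg (ϰ j)).lt_of_ne fun hzero => ?_
  have hsq := (hasSum_zero_iff_of_nonneg fun j => sq_nonneg (ϰ j)).1
    (hzero.symm ▸ hϰ.hasSum)
  have (j : ℕ+) : ϰ j = 0 := by simpa using congrFun hsq j
  simp [bigA, this] at hA

lemma one_le_cutoff (hϰ : Summable fun j => ϰ j ^ 2) (hρ : 0 < rhoSq ϰ) : 1 ≤ cutoff ϰ := by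
  obtain ⟨k, hk, -⟩ := exists_cutoff_eq hϰ hρ
  exact hk.symm ▸ k.2

lemma summable_pow_four (hϰ : Summable fun j => ϰ j ^ 2) : Summable fun j => ϰ j ^ 4 :=
  (summable_sq_of_nonneg (fun j => sq_nonneg (ϰ j)) hϰ).congr fun j => by ring

lemma tsum_pow_four_le (hϰ : Summable fun j => ϰ j ^ 2) (hρ : 0 < rhoSq ϰ)
    (hanti : Antitone fun j => ϰ j ^ 2) :
    ∑' j, ϰ j ^ 4 ≤ 2 * (cutoff ϰ * (ϰ 1 ^ 2) ^ 2) := by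
  obtain ⟨k, hk, hhalf⟩ := exists_cutoff_eq hϰ hρ
  have hone (j : ℕ+) : ϰ j ^ 2 ≤ ϰ 1 ^ 2 := hanti one_le
  have hrho : rhoSq ϰ ≤ 2 * (k * ϰ 1 ^ 2) := by
    have := Finset.sum_le_card_nsmul (Finset.Iic k) (fun j => ϰ j ^ 2) (ϰ 1 ^ 2) fun j _ => hone j
    rw [card_Iic_pnat, nsmul_eq_mul] at this
    linarith
  calc ∑' j, ϰ j ^ 4 ≤ ∑' j, ϰ j ^ 2 * ϰ 1 ^ 2 := by
        refine (summable_pow_four hϰ).tsum_le_tsum (fun j => ?_) (hϰ.mul_right _)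
        exact (le_of_eq (by ring)).trans (mul_le_mul_of_nonneg_left (hone j) (sq_nonneg _))
    _ = rhoSq ϰ * ϰ 1 ^ 2 := tsum_mul_right
    _ ≤ 2 * (k * ϰ 1 ^ 2) * ϰ 1 ^ 2 := by gcongr
    _ = 2 * (cutoff ϰ * (ϰ 1 ^ 2) ^ 2) := by rw [hk]; ring

lemma cutoff_mul_cutoffSq_sq_le (hϰ : Summable fun j => ϰ j ^ 2) (hρ : 0 < rhoSq ϰ)
    (hanti : Antitone fun j => ϰ j ^ 2) : cutoff ϰ * cutoffSq ϰ ^ 2 ≤ ∑' j, ϰ j ^ 4 := by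
  obtain ⟨k, hk, -⟩ := exists_cutoff_eq hϰ hρ
  have hterm (j : ℕ+) (hj : j ∈ Finset.Iic k) : (ϰ k ^ 2) ^ 2 ≤ ϰ j ^ 4 :=
    (pow_le_pow_left₀ (sq_nonneg _) (hanti (Finset.mem_Iic.1 hj)) 2).trans_eq (by ring)
  rw [cutoffSq, hk, sqAt_coe, ← nsmul_eq_mul, ← card_Iic_pnat k]
  exact (Finset.card_nsmul_le_sum _ _ _ hterm).trans
    ((summable_pow_four hϰ).sum_le_tsum _ fun j _ => by positivity)

end Cutoff

section WeightAsymptotics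

variable {ϰ : ℝ → ℕ+ → ℝ} {r ω : ℝ}

lemma CondA2.rhoSq_pos (hA2 : CondA2 ϰ) (hsum : ∀ ε, 0 < ε → Summable fun j => ϰ ε j ^ 2)
    {ε : ℝ} (hε : 0 < ε) : 0 < rhoSq (ϰ ε) := by
  obtain ⟨C₁, _, hC₁, -, hA⟩ := hA2
  exact SignalDetection.rhoSq_pos (hsum ε hε) (hC₁.trans (hA ε hε).1)

lemma CondA2.tsum_pow_four_isTheta (hA2 : CondA2 ϰ) :
    (fun ε => ∑' j, ϰ ε j ^ 4) =Θ[𝓝[>] 0] fun ε => ε ^ 4 := by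
  obtain ⟨C₁, C₂, hC₁, -, hA⟩ := hA2
  have hbounds : ∀ᶠ ε in 𝓝[>] 0,
      C₁ * ε ^ 4 ≤ ∑' j, ϰ ε j ^ 4 ∧ ∑' j, ϰ ε j ^ 4 ≤ C₂ * ε ^ 4 := by
    filter_upwards [self_mem_nhdsWithin] with ε (hε : 0 < ε)
    have hbigA : ∑' j, ϰ ε j ^ 4 = bigA (ϰ ε) ε * ε ^ 4 := by
      rw [bigA]
      field_simp
    rw [hbigA]
    exact ⟨by gcongr; exact (hA ε hε).1.le, by gcongr; exact (hA ε hε).2.le⟩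
  have hnonneg (ε : ℝ) : 0 ≤ ∑' j, ϰ ε j ^ 4 := tsum_nonneg fun j => by positivity
  refine ⟨IsBigO.of_bound C₂ ?_, IsBigO.of_bound C₁⁻¹ ?_⟩ <;>
    filter_upwards [hbounds] with ε hε <;>
    rw [Real.norm_of_nonneg (hnonneg ε), Real.norm_of_nonneg (by positivity)]
  · exact hε.2
  · exact (le_inv_mul_iff₀ hC₁).2 hε.1

lemma cutoff_mul_cutoffSq_sq_isTheta (hsum : ∀ ε, 0 < ε → Summable fun j => ϰ ε j ^ 2)
    (hA1 : CondA1 ϰ) (hA2 : CondA2 ϰ)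
    (hfirst : (fun ε => ϰ ε 1 ^ 2) =Θ[𝓝[>] 0] fun ε => cutoffSq (ϰ ε)) :
    (fun ε => (cutoff (ϰ ε) : ℝ) * cutoffSq (ϰ ε) ^ 2) =Θ[𝓝[>] 0] fun ε => ε ^ 4 := by
  have hnonneg (ε : ℝ) : 0 ≤ ∑' j, ϰ ε j ^ 4 := tsum_nonneg fun j => by positivity
  constructor
  · refine IsBigO.trans (IsBigO.of_bound 1 ?_) hA2.tsum_pow_four_isTheta.1
    filter_upwards [self_mem_nhdsWithin] with ε hε
    rw [one_mul, Real.norm_of_nonneg (by positivity), Real.norm_of_nonneg (hnonneg ε)]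
    exact cutoff_mul_cutoffSq_sq_le (hsum ε hε) (hA2.rhoSq_pos hsum hε) (hA1 ε hε)
  · refine hA2.tsum_pow_four_isTheta.2.trans ((IsBigO.of_bound 2 ?_).trans
      ((isBigO_refl (fun ε => (cutoff (ϰ ε) : ℝ)) _).mul (hfirst.1.pow 2)))
    filter_upwards [self_mem_nhdsWithin] with ε hε
    rw [Real.norm_of_nonneg (hnonneg ε), Real.norm_of_nonneg (by positivity)]
    exact tsum_pow_four_le (hsum ε hε) (hA2.rhoSq_pos hsum hε) (hA1 ε hε)

lemma cutoffSq_isTheta (hsum : ∀ ε, 0 < ε → Summable fun j => ϰ ε j ^ 2)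
    (hA1 : CondA1 ϰ) (hA2 : CondA2 ϰ)
    (hfirst : (fun ε => ϰ ε 1 ^ 2) =Θ[𝓝[>] 0] fun ε => cutoffSq (ϰ ε))
    (hk : (fun ε => (cutoff (ϰ ε) : ℝ)) =Θ[𝓝[>] 0] fun ε => ε ^ (-4 + 8 * r + 4 * ω)) :
    (fun ε => cutoffSq (ϰ ε)) =Θ[𝓝[>] 0] fun ε => ε ^ (4 - 4 * r - 2 * ω) := by
  have hpos : ∀ᶠ ε : ℝ in 𝓝[>] 0, 0 < ε := self_mem_nhdsWithin
  have hdiv := (cutoff_mul_cutoffSq_sq_isTheta hsum hA1 hA2 hfirst).div hk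
  have hleft : (fun ε => (cutoff (ϰ ε) : ℝ) * cutoffSq (ϰ ε) ^ 2 / cutoff (ϰ ε)) =ᶠ[𝓝[>] 0]
      (fun ε => cutoffSq (ϰ ε)) ^ 2 := by
    filter_upwards [hpos] with ε hε
    have := one_le_cutoff (hsum ε hε) (hA2.rhoSq_pos hsum hε)
    exact mul_div_cancel_left₀ _ (by positivity)
  have hright : (fun ε : ℝ => ε ^ 4 / ε ^ (-4 + 8 * r + 4 * ω)) =ᶠ[𝓝[>] 0]
      (fun ε => ε ^ (4 - 4 * r - 2 * ω)) ^ 2 := by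
    filter_upwards [hpos] with ε hε
    rw [Pi.pow_apply, ← Real.rpow_mul_natCast hε.le, ← Real.rpow_natCast, ← Real.rpow_sub hε]
    congr 1
    push_cast
    ring
  have hsq := (hleft.symm.trans_isTheta hdiv).trans_eventuallyEq hright
  exact ⟨hsq.1.of_pow two_ne_zero, hsq.2.of_pow two_ne_zero⟩

lemma tendsto_rpow_nhdsGT_zero {a : ℝ} (ha : 0 < a) :
    Tendsto (fun x : ℝ => x ^ a) (𝓝[>] 0) (𝓝 0) := by
  have h := (Real.continuousAt_rpow_const 0 a (Or.inr ha.le)).tendsto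
  rw [Real.zero_rpow ha.ne'] at h
  exact h.mono_left nhdsWithin_le_nhds

lemma weightsNegligible_rpow (hω : 2 * ω < 1 - 2 * r) (hA1 : CondA1 ϰ)
    (hfirst : (fun ε => ϰ ε 1 ^ 2) =Θ[𝓝[>] 0] fun ε => cutoffSq (ϰ ε))
    (hcutoffSq : (fun ε => cutoffSq (ϰ ε)) =Θ[𝓝[>] 0] fun ε => ε ^ (4 - 4 * r - 2 * ω)) :
    WeightsNegligible ϰ fun ε => ε ^ (-2 * ω) := by
  have hpos : ∀ᶠ ε : ℝ in 𝓝[>] 0, 0 < ε := self_mem_nhdsWithin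
  have horder : (fun ε => ε ^ (-2 * ω) * (ε⁻¹ ^ 2 * ϰ ε 1 ^ 2)) =O[𝓝[>] 0]
      fun ε => ε ^ (-2 * ω) * (ε⁻¹ ^ 2 * ε ^ (4 - 4 * r - 2 * ω)) :=
    (isBigO_refl _ _).mul ((isBigO_refl _ _).mul (hfirst.trans hcutoffSq).1)
  have hexponent : (fun ε : ℝ => ε ^ (-2 * ω) * (ε⁻¹ ^ 2 * ε ^ (4 - 4 * r - 2 * ω)))
      =ᶠ[𝓝[>] 0] fun ε => ε ^ (2 - 4 * r - 4 * ω) := by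
    filter_upwards [hpos] with ε hε
    rw [inv_pow, ← Real.rpow_natCast, ← Real.rpow_neg hε.le, ← Real.rpow_add hε,
      ← Real.rpow_add hε]
    congr 1
    push_cast
    ring
  have hlim := (horder.trans_eventuallyEq hexponent).trans_tendsto
    (tendsto_rpow_nhdsGT_zero (by linarith))
  intro η hη
  filter_upwards [hpos, hlim.eventually_le_const hη] with ε hε hle j
  refine le_trans ?_ hle
  refine mul_le_mul_of_nonneg_left (mul_le_mul_of_nonneg_left ?_ (by positivity)) (by positivity)
  exact hA1 ε hε one_le

end WeightAsymptotics

section PartialSums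

variable {φ : ℕ+ → L2} {S : L2} {n : ℕ+}

/-- The span of `φ_1, …, φ_n`, that is the signals of frequency at most `n`. -/
def lowSpan (φ : ℕ+ → L2) (n : ℕ+) : Submodule ℝ L2 := Submodule.span ℝ (φ '' Set.Iic n)

instance finiteDimensional_lowSpan (φ : ℕ+ → L2) (n : ℕ+) : FiniteDimensional ℝ (lowSpan φ n) :=
  FiniteDimensional.span_of_finite ℝ ((Set.finite_Iic n).image φ)

/-- The orthogonal projection of `L₂(0,1)` onto the signals of frequency at most `n`; by
`lowPass_apply` it takes `S` to the partial sum `∑_{j ≤ n} θ_j φ_j` of its Fourier series. -/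
def lowPass (φ : ℕ+ → L2) (n : ℕ+) : L2 →L[ℝ] L2 := (lowSpan φ n).starProjection

lemma lowPass_apply (hφ : Orthonormal ℝ φ) (n : ℕ+) (S : L2) :
    lowPass φ n S = ∑ j ∈ Finset.Iic n, coeff φ S j • φ j := by
  refine Submodule.eq_starProjection_of_mem_orthogonal (K := lowSpan φ n) ?_ ?_
  · exact Submodule.sum_mem _ fun j hj => Submodule.smul_mem _ _
      (Submodule.subset_span ⟨j, Finset.mem_Iic.1 hj, rfl⟩)
  · rw [← Submodule.span_singleton_le_iff_mem, Submodule.le_orthogonal_iff_le_orthogonal]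
    refine Submodule.span_le.2 ?_
    rintro _ ⟨j, hj, rfl⟩
    rw [SetLike.mem_coe, Submodule.mem_orthogonal_singleton_iff_inner_left, inner_sub_right,
      hφ.inner_right_sum _ (Finset.mem_Iic.2 hj), coeff, sub_self]

lemma norm_lowPass_le (φ : ℕ+ → L2) (n : ℕ+) (S : L2) : ‖lowPass φ n S‖ ≤ ‖S‖ :=
  Submodule.norm_starProjection_apply_le _ _

lemma inner_lowPass_left (φ : ℕ+ → L2) (n : ℕ+) (S T : L2) :
    inner ℝ (lowPass φ n S) T = inner ℝ S (lowPass φ n T) :=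
  Submodule.inner_starProjection_left_eq_right _ _ _

lemma lowPass_lowPass (φ : ℕ+ → L2) (n : ℕ+) (S : L2) :
    lowPass φ n (lowPass φ n S) = lowPass φ n S :=
  Submodule.starProjection_eq_self_iff.2 (Submodule.starProjection_apply_mem _ _)

lemma norm_sub_lowPass_le (φ : ℕ+ → L2) (n : ℕ+) (S : L2) : ‖S - lowPass φ n S‖ ≤ ‖S‖ := by
  rw [lowPass, ← Submodule.starProjection_orthogonal_val]
  exact Submodule.norm_starProjection_apply_le _ _

lemma inner_sub_lowPass (φ : ℕ+ → L2) (n : ℕ+) (S : L2) :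
    inner ℝ (S - lowPass φ n S) (lowPass φ n S) = 0 := by
  rw [← inner_lowPass_left, map_sub, lowPass_lowPass, sub_self, inner_zero_left]

lemma norm_sub_lowPass_sq (φ : ℕ+ → L2) (n : ℕ+) (S : L2) :
    ‖S - lowPass φ n S‖ ^ 2 = ‖S‖ ^ 2 - ‖lowPass φ n S‖ ^ 2 := by
  have := norm_add_sq_eq_norm_sq_add_norm_sq_real (inner_sub_lowPass φ n S)
  rw [sub_add_cancel] at this
  nlinarith

lemma coeff_lowPass (hφ : Orthonormal ℝ φ) (n : ℕ+) (S : L2) (j : ℕ+) :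
    coeff φ (lowPass φ n S) j = if j ≤ n then coeff φ S j else 0 := by
  simp only [lowPass_apply hφ, coeff, inner_sum, inner_smul_right, orthonormal_iff_ite.1 hφ,
    mul_ite, mul_one, mul_zero, Finset.sum_ite_eq, Finset.mem_Iic]

lemma norm_lowPass_sq (hφ : Orthonormal ℝ φ) (n : ℕ+) (S : L2) :
    ‖lowPass φ n S‖ ^ 2 = ∑ j ∈ Finset.Iic n, coeff φ S j ^ 2 := by
  rw [← real_inner_self_eq_norm_sq, lowPass_apply hφ, hφ.inner_sum]
  exact Finset.sum_congr rfl fun j _ => (sq _).symm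

lemma norm_sq_le_of_inner_sub_eq_zero {T : L2} (hT : inner ℝ T (S - T) = 0) :
    ‖T‖ ^ 2 ≤ ‖S‖ * (‖lowPass φ n T‖ + ‖S - lowPass φ n S‖) := by
  rw [inner_sub_right, real_inner_self_eq_norm_sq, sub_eq_zero] at hT
  have hle : ‖T‖ ≤ ‖S‖ := by
    have := real_inner_le_norm T S
    by_contra! hlt
    nlinarith [norm_nonneg S]
  have hlow : inner ℝ T (lowPass φ n S) ≤ ‖lowPass φ n T‖ * ‖S‖ := by
    rw [← inner_lowPass_left]
    exact real_inner_le_norm _ _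
  have hhigh : inner ℝ T (S - lowPass φ n S) ≤ ‖S‖ * ‖S - lowPass φ n S‖ :=
    (real_inner_le_norm _ _).trans (by gcongr)
  rw [inner_sub_right, hT] at hhigh
  linarith

end PartialSums

section SignalBounds

variable {φ : ℕ+ → L2} {ϰ : ℕ+ → ℝ}

lemma summable_coeff_sq (hφ : Orthonormal ℝ φ) (S : L2) : Summable fun j => coeff φ S j ^ 2 :=
  (hφ.inner_products_summable (x := S)).congr fun j => by rw [coeff, Real.norm_eq_abs, sq_abs]

lemma tsum_coeff_sq_le (hφ : Orthonormal ℝ φ) (S : L2) : ∑' j, coeff φ S j ^ 2 ≤ ‖S‖ ^ 2 := by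
  simpa only [coeff, Real.norm_eq_abs, sq_abs] using hφ.tsum_inner_products_le (x := S)

lemma le_signal_of_antitone (hφ : Orthonormal ℝ φ) (hϰ : Summable fun j => ϰ j ^ 2)
    (hanti : Antitone fun j => ϰ j ^ 2) (ε : ℝ) (S : L2) (n : ℕ+) :
    ε⁻¹ ^ 4 * (ϰ n ^ 2 * ‖lowPass φ n S‖ ^ 2) ≤ signal φ ϰ ε S := by
  refine mul_le_mul_of_nonneg_left ?_ (by positivity)
  calc ϰ n ^ 2 * ‖lowPass φ n S‖ ^ 2
      = ∑ j ∈ Finset.Iic n, ϰ n ^ 2 * coeff φ S j ^ 2 := by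
        rw [norm_lowPass_sq hφ, Finset.mul_sum]
    _ ≤ ∑ j ∈ Finset.Iic n, ϰ j ^ 2 * coeff φ S j ^ 2 := Finset.sum_le_sum fun j hj =>
        mul_le_mul_of_nonneg_right (hanti (Finset.mem_Iic.1 hj)) (sq_nonneg _)
    _ ≤ ∑' j, ϰ j ^ 2 * coeff φ S j ^ 2 :=
        (summable_mul_coeff_sq hφ hϰ S).sum_le_tsum _ fun j _ => by positivity

lemma signal_sub_lowPass_le (hφ : Orthonormal ℝ φ) (hϰ : Summable fun j => ϰ j ^ 2)
    (hanti : Antitone fun j => ϰ j ^ 2) (ε : ℝ) (S : L2) (n : ℕ+) :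
    signal φ ϰ ε (S - lowPass φ n S) ≤ ε⁻¹ ^ 4 * (ϰ n ^ 2 * ‖S‖ ^ 2) := by
  refine mul_le_mul_of_nonneg_left ?_ (by positivity)
  have hterm (j : ℕ+) :
      ϰ j ^ 2 * coeff φ (S - lowPass φ n S) j ^ 2 ≤ ϰ n ^ 2 * coeff φ S j ^ 2 := by
    have hcoeff : coeff φ (S - lowPass φ n S) j = coeff φ S j - coeff φ (lowPass φ n S) j :=
      inner_sub_right _ _ _
    rw [hcoeff, coeff_lowPass hφ]
    split_ifs with hj
    · rw [sub_self, zero_pow two_ne_zero, mul_zero]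
      positivity
    · rw [sub_zero]
      exact mul_le_mul_of_nonneg_right (hanti (not_le.1 hj).le) (sq_nonneg _)
  calc ∑' j, ϰ j ^ 2 * coeff φ (S - lowPass φ n S) j ^ 2
      ≤ ∑' j, ϰ n ^ 2 * coeff φ S j ^ 2 :=
        (summable_mul_coeff_sq hφ hϰ _).tsum_le_tsum hterm ((summable_coeff_sq hφ S).mul_left _)
    _ = ϰ n ^ 2 * ∑' j, coeff φ S j ^ 2 := tsum_mul_left
    _ ≤ ϰ n ^ 2 * ‖S‖ ^ 2 := by gcongr; exact tsum_coeff_sq_le hφ S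

end SignalBounds

section BesovBall

variable {φ : ℕ+ → L2} {s P₀ P₁ : ℝ} {S : L2}

lemma besovBall_mono (hP : P₀ ≤ P₁) : besovBall φ s P₀ ⊆ besovBall φ s P₁ :=
  fun _ hS => ⟨hS.1, fun lam hlam => (hS.2 lam hlam).trans hP⟩

lemma zero_mem_besovBall (φ : ℕ+ → L2) (s : ℝ) (hP : 0 ≤ P₀) : 0 ∈ besovBall φ s P₀ := by
  refine ⟨?_, fun lam _ => ?_⟩ <;> simp [coeff, hP]

lemma norm_sq_eq_tsum_coeff_sq (hS : HasSum (fun j => coeff φ S j • φ j) S) :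
    ‖S‖ ^ 2 = ∑' j, coeff φ S j ^ 2 := by
  rw [← real_inner_self_eq_norm_sq]
  refine ((hS.mapL (innerSL ℝ S)).congr_fun fun j => ?_).tsum_eq.symm
  rw [innerSL_apply_apply, inner_smul_right, real_inner_comm, sq, coeff]

lemma rpow_mul_norm_sub_lowPass_sq_le (hφ : Orthonormal ℝ φ) (hS : S ∈ besovBall φ s P₀)
    (n : ℕ+) : (n : ℝ) ^ (2 * s) * ‖S - lowPass φ n S‖ ^ 2 ≤ P₀ := by
  have hset : {j : ℕ+ | (n : ℝ) < (j : ℕ)} = (Finset.Iic n : Set ℕ+)ᶜ := by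
    ext j
    simp
  have htail : ‖S - lowPass φ n S‖ ^ 2 = ∑' j : {j : ℕ+ | (n : ℝ) < (j : ℕ)}, coeff φ S j ^ 2 := by
    rw [norm_sub_lowPass_sq, norm_sq_eq_tsum_coeff_sq hS.1, norm_lowPass_sq hφ,
      ← (summable_coeff_sq hφ S).sum_add_tsum_compl (s := Finset.Iic n), add_sub_cancel_left, hset]
  rw [htail]
  exact hS.2 n (by exact_mod_cast n.pos)

lemma tsum_coeff_lowPass_sq_subtype_le (hφ : Orthonormal ℝ φ) (n : ℕ+) (S : L2) (J : Set ℕ+) :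
    ∑' j : J, coeff φ (lowPass φ n S) j ^ 2 ≤ ‖S‖ ^ 2 := by
  refine (Summable.tsum_subtype_le _ J (fun j => sq_nonneg _) (summable_coeff_sq hφ _)).trans ?_
  refine (tsum_coeff_sq_le hφ _).trans ?_
  gcongr
  exact norm_lowPass_le φ n S

lemma lowPass_mem_besovBall (hφ : Orthonormal ℝ φ) (hs : 0 ≤ s) (n : ℕ+) (S : L2) :
    lowPass φ n S ∈ besovBall φ s ((n : ℝ) ^ (2 * s) * ‖S‖ ^ 2) := by
  constructor
  · have hfinite : HasSum (fun j => coeff φ (lowPass φ n S) j • φ j)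
        (∑ j ∈ Finset.Iic n, coeff φ (lowPass φ n S) j • φ j) :=
      hasSum_sum_of_ne_finset_zero fun j hj => by
        rw [coeff_lowPass hφ, if_neg (by simpa using hj), zero_smul]
    rwa [← lowPass_apply hφ, lowPass_lowPass] at hfinite
  · intro lam hlam
    rcases le_or_gt (n : ℝ) lam with hn | hn
    · have hzero (j : {j : ℕ+ // lam < ((j : ℕ) : ℝ)}) : coeff φ (lowPass φ n S) j ^ 2 = 0 := by
        have hj : n < j.1 := by exact_mod_cast hn.trans_lt j.2
        rw [coeff_lowPass hφ, if_neg (not_le.2 hj), zero_pow two_ne_zero]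
      simp only [hzero, tsum_zero, mul_zero]
      positivity
    · refine mul_le_mul (Real.rpow_le_rpow hlam.le hn.le (by positivity)) ?_
        (tsum_nonneg fun j => sq_nonneg _) (by positivity)
      exact tsum_coeff_lowPass_sq_subtype_le hφ n S {j : ℕ+ | lam < ((j : ℕ) : ℝ)}

end BesovBall

section Level

variable {φ : ℕ+ → L2} {ϰ : ℕ+ → ℝ} {c s P₀ : ℝ} {S : L2}

/-- The frequency `[c k_ε]`, at the scale of the cutoff; as a positive integer it is meaningful when
`1 ≤ c k_ε`. -/
def level (ϰ : ℕ+ → ℝ) (c : ℝ) : ℕ+ := ⌊c * (cutoff ϰ : ℝ)⌋₊.toPNat'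

lemma coe_level (hc : 1 ≤ c) (hk : 1 ≤ cutoff ϰ) : (level ϰ c : ℕ) = ⌊c * (cutoff ϰ : ℝ)⌋₊ :=
  PNat.toPNat'_coe (Nat.floor_pos.2 (one_le_mul_of_one_le_of_one_le hc (Nat.one_le_cast.2 hk)))

lemma level_le (hc : 1 ≤ c) (hk : 1 ≤ cutoff ϰ) : (level ϰ c : ℝ) ≤ c * cutoff ϰ := by
  rw [coe_level hc hk]
  exact Nat.floor_le (by positivity)

lemma half_mul_cutoff_le_level (hc : 1 ≤ c) (hk : 1 ≤ cutoff ϰ) :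
    c / 2 * cutoff ϰ ≤ (level ϰ c : ℝ) := by
  have hlt := Nat.lt_floor_add_one (c * (cutoff ϰ : ℝ))
  rw [← coe_level hc hk] at hlt
  have : (1 : ℝ) ≤ (level ϰ c : ℝ) := Nat.one_le_cast.2 (level ϰ c).pos
  linarith

lemma lowPass_level_mem_besovBall (hφ : Orthonormal ℝ φ) (hs : 0 ≤ s) (hc : 1 ≤ c)
    (hk : 1 ≤ cutoff ϰ) (S : L2) :
    lowPass φ (level ϰ c) S ∈
      besovBall φ s (c ^ (2 * s) * ((cutoff ϰ : ℝ) ^ (2 * s) * ‖S‖ ^ 2)) := by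
  refine besovBall_mono ?_ (lowPass_mem_besovBall hφ hs (level ϰ c) S)
  rw [← mul_assoc, ← Real.mul_rpow (by positivity) (by positivity)]
  gcongr
  exact level_le hc hk

lemma rpow_mul_norm_sub_lowPass_level_sq_le (hφ : Orthonormal ℝ φ) (hs : 0 ≤ s) (hc : 1 ≤ c)
    (hk : 1 ≤ cutoff ϰ) (hS : S ∈ besovBall φ s P₀) :
    (c / 2) ^ (2 * s) * ((cutoff ϰ : ℝ) ^ (2 * s) * ‖S - lowPass φ (level ϰ c) S‖ ^ 2) ≤ P₀ := by
  refine le_trans ?_ (rpow_mul_norm_sub_lowPass_sq_le hφ hS (level ϰ c))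
  rw [← mul_assoc, ← Real.mul_rpow (by positivity) (by positivity)]
  gcongr
  exact half_mul_cutoff_le_level hc hk

lemma norm_sub_lowPass_level_le {B δ g : ℝ} (hφ : Orthonormal ℝ φ) (hs : 0 ≤ s) (hc : 1 ≤ c)
    (hk : 1 ≤ cutoff ϰ) (hS : S ∈ besovBall φ s P₀) (hδ : 0 ≤ δ) (hg : 0 ≤ g) (hB : 0 ≤ B)
    (hcP : P₀ * B ≤ (c / 2) ^ (2 * s) * δ ^ 2)
    (hscale : 1 ≤ B * ((cutoff ϰ : ℝ) ^ (2 * s) * g ^ 2)) :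
    ‖S - lowPass φ (level ϰ c) S‖ ≤ δ * g := by
  have htail := rpow_mul_norm_sub_lowPass_level_sq_le hφ hs hc hk hS
  set a := (c / 2) ^ (2 * s)
  set K := (cutoff ϰ : ℝ) ^ (2 * s)
  set x := ‖S - lowPass φ (level ϰ c) S‖
  have ha : 0 < a := by positivity
  have hK : 0 < K := by positivity
  have hKx : K * x ^ 2 * B ≤ δ ^ 2 := by
    refine le_of_mul_le_mul_left (le_trans ?_ hcP) ha
    rw [← mul_assoc]
    gcongr
  refine (sq_le_sq₀ (norm_nonneg _) (by positivity)).1 (le_of_mul_le_mul_left ?_ hK)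
  calc K * x ^ 2 ≤ K * x ^ 2 * (B * (K * g ^ 2)) := le_mul_of_one_le_right (by positivity) hscale
    _ = K * x ^ 2 * B * (K * g ^ 2) := by ring
    _ ≤ δ ^ 2 * (K * g ^ 2) := by gcongr
    _ = K * (δ * g) ^ 2 := by ring

end Level

section Approximation

variable {φ : ℕ+ → L2} {ϰ : ℝ → ℕ+ → ℝ} {r s ω : ℝ} {S : ℝ → L2}

/-- Up to an error `δ ε^{2r}` with `δ` arbitrarily small, the signals `S ε` have frequencies of the
order of the cutoff `k_ε`. -/
def LowFrequency (φ : ℕ+ → L2) (ϰ : ℝ → ℕ+ → ℝ) (r : ℝ) (S : ℝ → L2) : Prop :=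
  ∀ δ : ℝ, 0 < δ → ∃ c : ℝ, 1 < c ∧ ∀ᶠ ε in 𝓝[>] (0 : ℝ),
    ‖S ε - lowPass φ (level (ϰ ε) c) (S ε)‖ ≤ δ * ε ^ (2 * r)

/-- Up to an error `δ ε^{2r}` with `δ` arbitrarily small, the signals `S ε` belong to a Besov ball
of smoothness `s` whose radius does not depend on `ε`. -/
def BesovApproximable (φ : ℕ+ → L2) (s r : ℝ) (S : ℝ → L2) : Prop :=
  ∀ δ : ℝ, 0 < δ → ∃ (P₀ : ℝ) (S₁ : ℝ → L2), 0 < P₀ ∧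
    (∀ ε : ℝ, 0 < ε → S₁ ε ∈ besovBall φ s P₀) ∧
    ∃ ε₀ : ℝ, 0 < ε₀ ∧ ∀ ε : ℝ, 0 < ε → ε < ε₀ → ‖S ε - S₁ ε‖ ≤ δ * ε ^ (2 * r)

lemma LowFrequency.besovApproximable (h : LowFrequency φ ϰ r S) (hφ : Orthonormal ℝ φ)
    (hs : 0 ≤ s) (hk : ∀ᶠ ε in 𝓝[>] 0, 1 ≤ cutoff (ϰ ε))
    (hS : (fun ε => (cutoff (ϰ ε) : ℝ) ^ (2 * s) * ‖S ε‖ ^ 2) =O[𝓝[>] 0] fun _ => (1 : ℝ)) :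
    BesovApproximable φ s r S := by
  intro δ hδ
  obtain ⟨c, hc, hclose⟩ := h δ hδ
  obtain ⟨B, hB, hbound⟩ := hS.exists_pos
  obtain ⟨ε₀, hε₀ : 0 < ε₀, hev⟩ :=
    mem_nhdsGT_iff_exists_Ioo_subset.1 (hk.and (hbound.bound.and hclose))
  refine ⟨c ^ (2 * s) * B, fun ε => if ε < ε₀ then lowPass φ (level (ϰ ε) c) (S ε) else 0,
    by positivity, fun ε hε => ?_, ε₀, hε₀, fun ε hε hlt => ?_⟩
  · dsimp only
    split_ifs with hlt
    · obtain ⟨hk, hB, -⟩ := hev ⟨hε, hlt⟩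
      refine besovBall_mono ?_ (lowPass_level_mem_besovBall hφ hs hc.le hk (S ε))
      gcongr
      simpa only [norm_one, mul_one] using (Real.le_norm_self _).trans hB
    · exact zero_mem_besovBall φ s (by positivity)
  · simp only [if_pos hlt]
    exact (hev ⟨hε, hlt⟩).2.2

lemma norm_sub_lowPass_le_add (φ : ℕ+ → L2) (n : ℕ+) (S T : L2) :
    ‖S - lowPass φ n S‖ ≤ ‖S - T‖ + ‖T - lowPass φ n T‖ := by
  have hsplit : S - lowPass φ n S = (S - T - lowPass φ n (S - T)) + (T - lowPass φ n T) := by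
    rw [map_sub]
    abel
  rw [hsplit]
  exact (norm_add_le _ _).trans (add_le_add_left (norm_sub_lowPass_le φ n (S - T)) _)

lemma BesovApproximable.lowFrequency (h : BesovApproximable φ s r S) (hφ : Orthonormal ℝ φ)
    (hs : 0 < s) (hk : ∀ᶠ ε in 𝓝[>] 0, 1 ≤ cutoff (ϰ ε))
    (hscale : (fun _ => (1 : ℝ)) =O[𝓝[>] 0]
      fun ε => (cutoff (ϰ ε) : ℝ) ^ (2 * s) * (ε ^ (2 * r)) ^ 2) :
    LowFrequency φ ϰ r S := by
  intro δ hδ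
  obtain ⟨P₀, S₁, -, hS₁, ε₀, hε₀, hclose⟩ := h (δ / 2) (half_pos hδ)
  obtain ⟨B, hB, hbound⟩ := hscale.exists_pos
  have hlim : Tendsto (fun c : ℝ => (c / 2) ^ (2 * s)) atTop atTop :=
    (tendsto_rpow_atTop (by positivity)).comp (tendsto_id.atTop_div_const two_pos)
  obtain ⟨c, hc, hcP⟩ := ((eventually_gt_atTop 1).and
    (hlim.eventually_ge_atTop (P₀ * B / (δ / 2) ^ 2))).exists
  refine ⟨c, hc, ?_⟩
  filter_upwards [self_mem_nhdsWithin, hk, hbound.bound, Ioo_mem_nhdsGT hε₀]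
    with ε (hε : 0 < ε) hk hB₁ hlt
  rw [norm_one, Real.norm_of_nonneg (by positivity)] at hB₁
  rw [div_le_iff₀ (by positivity)] at hcP
  have htail := norm_sub_lowPass_level_le hφ hs.le hc.le hk (hS₁ ε hε) (by positivity)
    (by positivity) hB.le hcP hB₁
  set n := level (ϰ ε) c
  calc ‖S ε - lowPass φ n (S ε)‖ ≤ ‖S ε - S₁ ε‖ + ‖S₁ ε - lowPass φ n (S₁ ε)‖ :=
        norm_sub_lowPass_le_add φ n _ _
    _ ≤ δ / 2 * ε ^ (2 * r) + δ / 2 * ε ^ (2 * r) := add_le_add (hclose ε hε hlt.2) htail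
    _ = δ * ε ^ (2 * r) := by ring

lemma cutoff_rpow_mul_isTheta_one (hω : 2 * r + ω < 1)
    (hk : (fun ε => (cutoff (ϰ ε) : ℝ)) =Θ[𝓝[>] 0] fun ε => ε ^ (-4 + 8 * r + 4 * ω)) :
    (fun ε => (cutoff (ϰ ε) : ℝ) ^ (2 * (r / (2 - 4 * r - 2 * ω))) * (ε ^ (2 * r)) ^ 2)
      =Θ[𝓝[>] 0] fun _ => (1 : ℝ) := by
  have hpos : ∀ᶠ ε : ℝ in 𝓝[>] 0, 0 < ε := self_mem_nhdsWithin
  have hcutoff := (hk.rpow (r := 2 * (r / (2 - 4 * r - 2 * ω)))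
    (Eventually.of_forall fun ε => Nat.cast_nonneg _) (hpos.mono fun ε hε => by positivity)).mul
    (isTheta_refl (fun ε : ℝ => (ε ^ (2 * r)) ^ 2) _)
  refine hcutoff.trans_eventuallyEq ?_
  filter_upwards [hpos] with ε hε
  have hp : 2 - 4 * r - 2 * ω ≠ 0 := by linarith
  have hexponent : -4 + 8 * r + 4 * ω = -2 * (2 - 4 * r - 2 * ω) := by ring
  generalize 2 - 4 * r - 2 * ω = p at hp hexponent
  rw [hexponent, ← Real.rpow_mul hε.le, ← Real.rpow_mul_natCast hε.le, ← Real.rpow_add hε,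
    ← Real.rpow_zero ε]
  congr 1
  field_simp
  push_cast
  ring

end Approximation

section Orthogonal

variable {φ : ℕ+ → L2} {ϰ : ℝ → ℕ+ → ℝ} {r ω : ℝ} {R : ℝ → ℝ} {S : ℝ → L2}

lemma inv_pow_four_mul_cutoffSq_mul_isTheta
    (hcutoffSq : (fun ε => cutoffSq (ϰ ε)) =Θ[𝓝[>] 0] fun ε => ε ^ (4 - 4 * r - 2 * ω)) :
    (fun ε => ε⁻¹ ^ 4 * (cutoffSq (ϰ ε) * (ε ^ (2 * r)) ^ 2)) =Θ[𝓝[>] 0]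
      fun ε => ε ^ (-2 * ω) := by
  refine ((isTheta_refl _ _).mul (hcutoffSq.mul (isTheta_refl _ _))).trans_eventuallyEq ?_
  filter_upwards [self_mem_nhdsWithin] with ε (hε : 0 < ε)
  rw [inv_pow, ← Real.rpow_natCast ε, ← Real.rpow_neg hε.le, ← Real.rpow_mul_natCast hε.le,
    ← Real.rpow_add hε, ← Real.rpow_add hε]
  congr 1
  push_cast
  ring

lemma le_norm_lowPass_of_inner_sub_eq_zero {n : ℕ+} {S T : L2} {D c g : ℝ} (hD : 0 < D)
    (hc : 0 ≤ c) (hg : 0 < g) (hST : inner ℝ T (S - T) = 0) (hS : ‖S‖ ≤ D * g)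
    (hlow : ‖S - lowPass φ n S‖ ≤ c ^ 2 / (2 * D) * g) (hT : c * g ≤ ‖T‖) :
    c ^ 2 / (2 * D) * g ≤ ‖lowPass φ n T‖ := by
  have hDg : 0 < D * g := by positivity
  refine le_of_mul_le_mul_left (a := D * g) ?_ hDg
  have hsq : (c * g) ^ 2 ≤ D * g * (‖lowPass φ n T‖ + c ^ 2 / (2 * D) * g) := calc
    (c * g) ^ 2 ≤ ‖T‖ ^ 2 := by gcongr
    _ ≤ ‖S‖ * (‖lowPass φ n T‖ + ‖S - lowPass φ n S‖) := norm_sq_le_of_inner_sub_eq_zero hST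
    _ ≤ D * g * (‖lowPass φ n T‖ + c ^ 2 / (2 * D) * g) := by gcongr
  have hhalf : D * g * (c ^ 2 / (2 * D) * g) = (c * g) ^ 2 / 2 := by field_simp
  linarith

lemma LowFrequency.ldConsistentAlong_of_inner_sub_eq_zero {ι : Type} {l : Filter ι} {e : ι → ℝ}
    {T : ι → L2} (h : LowFrequency φ ϰ r S) (hφ : Orthonormal ℝ φ)
    (hsum : ∀ ε, 0 < ε → Summable fun j => ϰ ε j ^ 2) (hA1 : CondA1 ϰ) (hA2 : CondA2 ϰ)
    (hA4 : CondA4 ϰ) (hR : ∀ᶠ ε in 𝓝[>] 0, 0 < R ε) (hK : WeightsNegligible ϰ R)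
    (hscale : R =O[𝓝[>] 0] fun ε => ε⁻¹ ^ 4 * (cutoffSq (ϰ ε) * (ε ^ (2 * r)) ^ 2))
    (hS : (fun ε => ‖S ε‖) =O[𝓝[>] 0] fun ε => ε ^ (2 * r)) (he : Tendsto e l (𝓝[>] 0))
    (hST : ∀ i, inner ℝ (T i) (S (e i) - T i) = 0) {c₁ : ℝ} (hc₁ : 0 < c₁)
    (hT : ∀ᶠ i in l, c₁ * e i ^ (2 * r) ≤ ‖T i‖) :
    LDConsistentAlong φ ϰ R l e T := by
  obtain ⟨D, hD, hSD⟩ := hS.exists_pos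
  obtain ⟨B, hB, hRB⟩ := hscale.exists_pos
  obtain ⟨c, hc, hlow⟩ := h (c₁ ^ 2 / (2 * D)) (by positivity)
  obtain ⟨C, hC, hlevel⟩ := hA4.2 c hc
  set b := c₁ ^ 2 / (2 * D)
  refine ldConsistentAlong_of_eventually_mul_le_signal hφ hsum hA2 hR hK he
    (c := C * b ^ 2 / B) (by positivity) ?_
  filter_upwards [he.eventually self_mem_nhdsWithin, he.eventually hR, he.eventually hSD.bound,
    he.eventually hRB.bound, he.eventually hlow, hT] with i (hε : 0 < e i) hR hSD hRB hlow hT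
  have hg : 0 < e i ^ (2 * r) := by positivity
  have hcutoffSq : 0 ≤ cutoffSq (ϰ (e i)) := sq_nonneg _
  rw [norm_norm, Real.norm_of_nonneg hg.le] at hSD
  rw [Real.norm_of_nonneg hR.le, Real.norm_of_nonneg (by positivity)] at hRB
  have hlowT := le_norm_lowPass_of_inner_sub_eq_zero hD hc₁.le hg (hST i) hSD hlow hT
  set n := level (ϰ (e i)) c
  set g := e i ^ (2 * r)
  calc C * b ^ 2 / B * R (e i)
      ≤ C * b ^ 2 / B * (B * ((e i)⁻¹ ^ 4 * (cutoffSq (ϰ (e i)) * g ^ 2))) := by gcongr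
    _ = (e i)⁻¹ ^ 4 * (C * cutoffSq (ϰ (e i)) * (b * g) ^ 2) := by field_simp
    _ ≤ (e i)⁻¹ ^ 4 * (ϰ (e i) n ^ 2 * ‖lowPass φ n (T i)‖ ^ 2) := by
        gcongr
        exact hlevel _ hε
    _ ≤ signal φ (ϰ (e i)) (e i) (T i) :=
        le_signal_of_antitone hφ (hsum _ hε) (hA1 _ hε) (e i) (T i) n

lemma LowFrequency.purelyLDConsistent (h : LowFrequency φ ϰ r S) (hφ : Orthonormal ℝ φ)
    (hsum : ∀ ε, 0 < ε → Summable fun j => ϰ ε j ^ 2) (hA1 : CondA1 ϰ) (hA2 : CondA2 ϰ)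
    (hA4 : CondA4 ϰ) (hR : ∀ᶠ ε in 𝓝[>] 0, 0 < R ε) (hK : WeightsNegligible ϰ R)
    (hscale : R =O[𝓝[>] 0] fun ε => ε⁻¹ ^ 4 * (cutoffSq (ϰ ε) * (ε ^ (2 * r)) ^ 2))
    (hS : (fun ε => ‖S ε‖) =Θ[𝓝[>] 0] fun ε => ε ^ (2 * r)) :
    PurelyLDConsistent φ ϰ R r S := by
  constructor
  · obtain ⟨D, hD, hbound⟩ := hS.2.exists_pos
    refine h.ldConsistentAlong_of_inner_sub_eq_zero hφ hsum hA1 hA2 hA4 hR hK hscale hS.1 tendsto_id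
      (fun ε => by rw [sub_self, inner_zero_right]) (inv_pos.2 hD) ?_
    filter_upwards [self_mem_nhdsWithin, hbound.bound] with ε (hε : 0 < ε) hle
    rw [norm_norm, Real.norm_of_nonneg (by positivity)] at hle
    exact (inv_mul_le_iff₀ hD).2 hle
  · rintro ⟨e, T, c₁, he₀, he, hc₁, hST, hT, hnot⟩
    exact hnot (h.ldConsistentAlong_of_inner_sub_eq_zero hφ hsum hA1 hA2 hA4 hR hK hscale hS.1
      (tendsto_nhdsWithin_iff.2 ⟨he, Eventually.of_forall he₀⟩) hST hc₁
      (Eventually.of_forall fun i => (hT i).le))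

end Orthogonal

section HighFrequency

variable {φ : ℕ+ → L2} {ϰ : ℝ → ℕ+ → ℝ} {r : ℝ} {R : ℝ → ℝ} {S : ℝ → L2}

/-- Asymptotically, the weights far beyond the cutoff are negligible with respect to the weight at
the cutoff. This is the qualitative content of A3. -/
def TailNegligible (ϰ : ℝ → ℕ+ → ℝ) : Prop :=
  ∀ η : ℝ, 0 < η → ∃ c : ℝ, 1 < c ∧ ∀ᶠ ε in 𝓝[>] (0 : ℝ),
    sqAt (ϰ ε) ⌊c * (cutoff (ϰ ε) : ℝ)⌋₊ ≤ η * cutoffSq (ϰ ε)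

lemma CondA3.tailNegligible (hA3 : CondA3 ϰ) : TailNegligible ϰ := by
  obtain ⟨C, lam, -, hlam, hdecay⟩ := hA3
  intro η hη
  have hlim : Tendsto (fun c : ℝ => C * c ^ (-lam)) atTop (𝓝 0) := by
    simpa only [mul_zero] using (tendsto_rpow_neg_atTop (by linarith : 0 < lam)).const_mul C
  obtain ⟨c, hc, hcη⟩ := ((eventually_gt_atTop 1).and (hlim.eventually_le_const hη)).exists
  refine ⟨c, hc, ?_⟩
  filter_upwards [self_mem_nhdsWithin] with ε hε
  have hdecay := hdecay (c - 1) (sub_pos.2 hc) ε hε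
  rw [add_sub_cancel] at hdecay
  exact hdecay.le.trans (mul_le_mul_of_nonneg_right hcη (sq_nonneg _))

lemma not_ldConsistentAlong_sub_lowPass {ι : Type} {l : Filter ι} [l.NeBot] {e : ι → ℝ}
    {n : ι → ℕ+} (hφ : Orthonormal ℝ φ) (hsum : ∀ ε, 0 < ε → Summable fun j => ϰ ε j ^ 2)
    (hA1 : CondA1 ϰ) (hA2 : CondA2 ϰ) (hR : Tendsto R (𝓝[>] 0) atTop)
    (hK : WeightsNegligible ϰ R)
    (hscale : (fun ε => ε⁻¹ ^ 4 * (cutoffSq (ϰ ε) * (ε ^ (2 * r)) ^ 2)) =O[𝓝[>] 0] R)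
    (hS : (fun ε => ‖S ε‖) =O[𝓝[>] 0] fun ε => ε ^ (2 * r)) (he : Tendsto e l (𝓝[>] 0))
    (hn : (fun i => ϰ (e i) (n i) ^ 2) =o[l] fun i => cutoffSq (ϰ (e i))) :
    ¬ LDConsistentAlong φ ϰ R l e fun i => S (e i) - lowPass φ (n i) (S (e i)) := by
  refine not_ldConsistentAlong_of_tendsto_signal hφ hsum hA2 hR hK he
    (IsLittleO.tendsto_div_nhds_zero ?_)
  refine IsBigO.trans_isLittleO (IsBigO.of_bound 1 ?_)
    (((isBigO_refl _ _).mul_isLittleO (hn.mul_isBigO ((hS.comp_tendsto he).pow 2))).trans_isBigO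
      (hscale.comp_tendsto he))
  filter_upwards [he.eventually self_mem_nhdsWithin] with i (hε : 0 < e i)
  rw [one_mul, Real.norm_of_nonneg (signal_nonneg _ _ _ _)]
  exact (signal_sub_lowPass_le hφ (hsum _ hε) (hA1 _ hε) (e i) (S (e i)) (n i)).trans
    (Real.le_norm_self _)

lemma TailNegligible.exists_seq_of_not_lowFrequency (hϰ : TailNegligible ϰ)
    (h : ¬ LowFrequency φ ϰ r S) :
    ∃ (δ : ℝ) (e : ℕ → ℝ) (n : ℕ → ℕ+), 0 < δ ∧ (∀ i, 0 < e i) ∧ Tendsto e atTop (𝓝 0) ∧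
      (∀ i, δ * e i ^ (2 * r) < ‖S (e i) - lowPass φ (n i) (S (e i))‖) ∧
      (fun i => ϰ (e i) (n i) ^ 2) =o[atTop] fun i => cutoffSq (ϰ (e i)) := by
  unfold LowFrequency at h
  push Not at h
  obtain ⟨δ, hδ, hfar⟩ := h
  have hex (i : ℕ) : ∃ (ε : ℝ) (n : ℕ+), 0 < ε ∧ ε < 1 / ((i : ℝ) + 1) ∧
      δ * ε ^ (2 * r) < ‖S ε - lowPass φ n (S ε)‖ ∧
      ϰ ε n ^ 2 ≤ 1 / ((i : ℝ) + 1) * cutoffSq (ϰ ε) := by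
    have hi : (0 : ℝ) < 1 / ((i : ℝ) + 1) := by positivity
    obtain ⟨c, hc, htail⟩ := hϰ _ hi
    obtain ⟨ε, hfar, hε, htail⟩ :=
      ((hfar c hc).and_eventually (Eventually.and (Ioo_mem_nhdsGT hi) htail)).exists
    exact ⟨ε, level (ϰ ε) c, hε.1, hε.2, hfar, htail⟩
  choose e n he₀ he₁ hfar htail using hex
  refine ⟨δ, e, n, hδ, he₀, squeeze_zero (fun i => (he₀ i).le) (fun i => (he₁ i).le)
    tendsto_one_div_add_atTop_nhds_zero_nat, hfar, ?_⟩
  have hsmall := ((isLittleO_one_iff ℝ).2 tendsto_one_div_add_atTop_nhds_zero_nat).mul_isBigO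
    (isBigO_refl (fun i => cutoffSq (ϰ (e i))) atTop)
  simp only [one_mul] at hsmall
  refine IsBigO.trans_isLittleO (IsBigO.of_bound 1 (Eventually.of_forall fun i => ?_)) hsmall
  rw [one_mul, Real.norm_of_nonneg (sq_nonneg _)]
  exact (htail i).trans (Real.le_norm_self _)

lemma PurelyLDConsistent.lowFrequency (h : PurelyLDConsistent φ ϰ R r S) (hφ : Orthonormal ℝ φ)
    (hsum : ∀ ε, 0 < ε → Summable fun j => ϰ ε j ^ 2) (hA1 : CondA1 ϰ) (hA2 : CondA2 ϰ)
    (hϰ : TailNegligible ϰ) (hR : Tendsto R (𝓝[>] 0) atTop) (hK : WeightsNegligible ϰ R)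
    (hscale : (fun ε => ε⁻¹ ^ 4 * (cutoffSq (ϰ ε) * (ε ^ (2 * r)) ^ 2)) =O[𝓝[>] 0] R)
    (hS : (fun ε => ‖S ε‖) =O[𝓝[>] 0] fun ε => ε ^ (2 * r)) :
    LowFrequency φ ϰ r S := by
  by_contra hlow
  obtain ⟨δ, e, n, hδ, he₀, he, hfar, hn⟩ := hϰ.exists_seq_of_not_lowFrequency hlow
  refine h.2 ⟨e, fun i => S (e i) - lowPass φ (n i) (S (e i)), δ, he₀, he, hδ, fun i => ?_, hfar,
    not_ldConsistentAlong_sub_lowPass hφ hsum hA1 hA2 hR hK hscale hS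
      (tendsto_nhdsWithin_iff.2 ⟨he, Eventually.of_forall he₀⟩) hn⟩
  rw [sub_sub_cancel, inner_sub_lowPass]

end HighFrequency

end SignalDetection

end

open SignalDetection in
theorem mainTheorem5_general {φ : ℕ+ → L2} (hφ : Orthonormal ℝ φ) {r ω : ℝ} (hr : 0 < r)
    (hω₀ : 0 < 2 * ω) (hω₁ : 2 * ω < 1 - 2 * r) {ϰ : ℝ → ℕ+ → ℝ}
    (hsum : ∀ ε : ℝ, 0 < ε → Summable fun j => ϰ ε j ^ 2) (hA1 : CondA1 ϰ) (hA2 : CondA2 ϰ)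
    (htail : TailNegligible ϰ) (hA4 : CondA4 ϰ)
    (hk : (fun ε => (cutoff (ϰ ε) : ℝ)) =Θ[𝓝[>] (0 : ℝ)] fun ε => ε ^ (-4 + 8 * r + 4 * ω))
    {S : ℝ → L2} (hS : (fun ε => ‖S ε‖) =Θ[𝓝[>] (0 : ℝ)] fun ε => ε ^ (2 * r)) :
    PurelyLDConsistent φ ϰ (fun ε => ε ^ (-2 * ω)) r S ↔
      BesovApproximable φ (r / (2 - 4 * r - 2 * ω)) r S := by
  have hs : 0 < r / (2 - 4 * r - 2 * ω) := div_pos hr (by linarith)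
  have hpos : ∀ᶠ ε : ℝ in 𝓝[>] 0, 0 < ε := self_mem_nhdsWithin
  have hcutoff : ∀ᶠ ε in 𝓝[>] 0, 1 ≤ cutoff (ϰ ε) :=
    hpos.mono fun ε hε => one_le_cutoff (hsum ε hε) (hA2.rhoSq_pos hsum hε)
  have hR : Tendsto (fun ε : ℝ => ε ^ (-2 * ω)) (𝓝[>] 0) atTop :=
    tendsto_rpow_neg_nhdsGT_zero (by linarith)
  have hcutoffSq := cutoffSq_isTheta hsum hA1 hA2 hA4.1 hk
  have hK := weightsNegligible_rpow hω₁ hA1 hA4.1 hcutoffSq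
  have hscale := inv_pow_four_mul_cutoffSq_mul_isTheta hcutoffSq
  have hone := cutoff_rpow_mul_isTheta_one (by linarith) hk
  constructor
  · intro h
    exact (h.lowFrequency hφ hsum hA1 hA2 htail hR hK hscale.1 hS.1).besovApproximable hφ hs.le
      hcutoff (((isBigO_refl _ _).mul (hS.1.pow 2)).trans hone.1)
  · intro h
    exact (h.lowFrequency hφ hs hcutoff hone.2).purelyLDConsistent hφ hsum hA1 hA2 hA4
      (hR.eventually_gt_atTop 0) hK hscale.2 hS

theorem mainTheorem5
    (φ : ℕ+ → SignalDetection.L2) (hφ : Orthonormal ℝ φ)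
    (r ω : ℝ) (hr₀ : 0 < r) (hr₁ : r < 1 / 2) (hω₀ : 0 < 2 * ω) (hω₁ : 2 * ω < 1 - 2 * r)
    (ϰ : ℝ → ℕ+ → ℝ)
    (hsum : ∀ ε : ℝ, 0 < ε → Summable fun j => ϰ ε j ^ 2)
    (hA1 : SignalDetection.CondA1 ϰ) (hA2 : SignalDetection.CondA2 ϰ)
    (hA3 : SignalDetection.CondA3 ϰ) (hA4 : SignalDetection.CondA4 ϰ)
    (hk : (fun ε => (SignalDetection.cutoff (ϰ ε) : ℝ)) =Θ[𝓝[>] (0 : ℝ)]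
      fun ε => ε ^ (-4 + 8 * r + 4 * ω))
    (S : ℝ → SignalDetection.L2)
    (hS : (fun ε => ‖S ε‖) =Θ[𝓝[>] (0 : ℝ)] fun ε => ε ^ (2 * r)) :
    SignalDetection.PurelyLDConsistent φ ϰ (fun ε => ε ^ (-2 * ω)) r S ↔
      ∀ δ : ℝ, 0 < δ → ∃ (P₀ : ℝ) (S₁ : ℝ → SignalDetection.L2), 0 < P₀ ∧
        (∀ ε : ℝ, 0 < ε →
          S₁ ε ∈ SignalDetection.besovBall φ (r / (2 - 4 * r - 2 * ω)) P₀) ∧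
        ∃ ε₀ : ℝ, 0 < ε₀ ∧ ∀ ε : ℝ, 0 < ε → ε < ε₀ →
          ‖S ε - S₁ ε‖ ≤ δ * ε ^ (2 * r) :=
  mainTheorem5_general hφ hr₀ hω₀ hω₁ hsum hA1 hA2 hA3.tailNegligible hA4 hk hS
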